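/- **Setting.** Let $V\subset H\subset V^*$ be an evolution triple: $V$ a real separable reflexive Banach space, $H$ a real separable Hilbert space, the embedding $i:V\to H$ injective, continuous, dense and compact; $V$ is embedded in $V^*$ by $v\mapsto (i v,i\,\cdot)_H$. Let $U$ be a real reflexive Banach space, $T>0$, $\mathcal V=L^2(0,T;V)$, $\mathcal V^*=L^2(0,T;V^*)$, $\mathcal U=L^2(0,T;U)$. For $v:[0,T]\to V$ put $\|v\|_{BV^2(0,T;V^*)}^2=\sup\sum_j\|v(t_{j+1})-v(t_j)\|_{V^*}^2$, the supremum being over all partitions $0=t_0<\dots<t_m=T$, and let $M^{2,2}=M^{2,2}(0,T;V,V^*)=L^2(0,T;V)\cap BV^2(0,T;V^*)$ with the norm $\|v\|_{\mathcal V}+\|v\|_{BV^2(0,T;V^*)}$. For a locally Lipschitz $J:U\to\mathbb R$, $J^0(u;z)$ is the Clarke generalized directional derivative and $\partial J(u)\subset U^*$ the Clarke generalized gradient. **Assumptions.** * $H(A)$: $A:V\to V^*$ is pseudomonotone (as the multifunction $v\mapsto\{Av\}$: it is continuous from every finite-dimensional subspace into $V^*$ with the weak topology, and if $v_n\to v$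 weakly in $V$ and $\limsup\langle Av_n,v_n-v\rangle\le 0$, then $\langle Av,v-y\rangle\le\liminf\langle Av_n,v_n-y\rangle$ for all $y\in V$); $\|Av\|_{V^*}\le a+b\|v\|$ and $\langle Av,v\rangle\ge\alpha\|v\|^2-\beta\|v\|_H^2$ for all $v\in V$, where $a\ge0$, $b>0$, $\alpha>0$, $\beta\ge0$. * $H(A)_1$: $H(A)$ holds and there are $m_1\ge0$, $m_2>0$ with $\langle Au-Av,u-v\rangle\ge m_1\|u-v\|^2-m_2\|u-v\|_H^2$ for all $u,v\in V$. * $H(A)_2$: $H(A)$ holds and the Nemytskii operator $(\mathcal Av)(t)=A(v(t))$ is of class $(S_+)$ with respect to $M^{2,2}$: if $v_n\to v$ weakly in $\mathcal V$, $(v_n)$ is bounded in $M^{2,2}$ and $\limsup\langle\mathcal Av_n,v_n-v\rangle_{\mathcal V^*\times\mathcal V}\le0$, then $v_n\to v$ strongly in $\mathcal V$. * $H(J)$: $J:U\to\mathbb R$ is locally Lipschitz and $\|\xi\|_{U^*}\le c(1+\|u\|_U)$ for all $u\in U$, $\xi\in\partial J(u)$, where $c>0$. * $H_0$: $f\in\mathcal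 V^*$ and $u_0\in H$. * $H(U)$: $\iota:V\to U$ is linear, continuous and compact, and $(\bar\iota v)(t)=\iota(v(t))$ defines a compact mapping $\bar\iota:M^{2,2}\to\mathcal U$. * $H_{aux}$: at least one of the following holds: A) there is a continuous linear $p:H\to U$ with $p(i v)=\iota v$ for all $v\in V$; B) $\alpha>c\|\iota\|^2_{\mathcal L(V;U)}$; C) there are $d\ge0$, $1\le\sigma<2$ with $J^0(u;-u)\le d(1+\|u\|_U^\sigma)$ for all $u\in U$. **Rothe scheme.** Let $\tau=\tau_n\to0$, $\tau>0$, with $N=T/\tau$ an integer. Let $u_{0\tau}\in V$ with $u_{0\tau}\to u_0$ in $H$ and $\|u_{0\tau}\|\le C_0/\sqrt\tau$ for a constant $C_0>0$. Let $f^k_\tau\in V^*$ ($1\le k\le N$) be approximations of $f$, with $\bar f_\tau(t)=f^k_\tau$ for $t\in((k-1)\tau,k\tau]$, such that either * $f^k_\tau=f_{\epsilon}(k\tau)$ with $f_\epsilon(t)=\int_0^T\rho_\epsilon\bigl(t+\epsilon\tfrac{T-2t}{T}-s\bigr)f(s)\,ds$, where $\epsilon=\epsilon(\tau)>0$, $\epsilon(\tau)\to0$,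 $\rho_\epsilon\in C^\infty(\mathbb R)$, $\rho_\epsilon\ge0$, $\operatorname{supp}\rho_\epsilon\subset[-\epsilon,\epsilon]$, $\int_{\mathbb R}\rho_\epsilon=1$, and for some constant $C$ one has $\rho_\epsilon\le C/\epsilon$ and $\tau\le C\epsilon(\tau)$ along the sequence; or * the $f^k_\tau$ are arbitrary with $\bar f_\tau\to f$ strongly in $\mathcal V^*$. Let $(u^k_\tau)_{k=0}^N\subset V$ solve the Rothe problem: $u^0_\tau=u_{0\tau}$, and for each $k=1,\dots,N$ there is $\xi^k_\tau\in\partial J(\iota u^k_\tau)$ with $$\Bigl(\frac{u^k_\tau-u^{k-1}_\tau}{\tau},v\Bigr)_H+\langle Au^k_\tau,v\rangle+\langle\xi^k_\tau,\iota v\rangle_{U^*\times U}=\langle f^k_\tau,v\rangle\quad\text{for all }v\in V .$$ Let $u_\tau$ be the piecewise linear interpolant, $u_\tau(t)=(\frac t\tau-k+1)u^k_\tau+(k-\frac t\tau)u^{k-1}_\tau$ on $[(k-1)\tau,k\tau]$, and $\bar u_\tau$ the piecewise constant interpolant, $\bar u_\tau(t)=u^k_\tau$ on $((k-1)\tau,k\tau]$.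 **Theorem.** Assume $H(A)$, $H(J)$, $H_0$, $H(U)$ and $H_{aux}$, and that, along the sequence of time steps considered (for example a subsequence of a given one), $\bar u_\tau\to u$ weakly in $\mathcal V$ and weakly-$*$ in $L^\infty(0,T;H)$, $u_\tau\to u_1$ weakly in $\mathcal V$ and weakly-$*$ in $L^\infty(0,T;H)$, and $u_\tau'\to u_2$ weakly in $\mathcal V^*$. 1. If $H(A)_1$ holds, then $u_\tau\to u$ strongly in $C([0,T];H)$, that is, $u$ has a representative continuous from $[0,T]$ into $H$ and $u_\tau$ converges to it in $H$ uniformly on $[0,T]$. 2. If $H(A)_2$ holds, then $\bar u_\tau\to u$ strongly in $\mathcal V$. -/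

import Mathlib

open MeasureTheory Filter Topology
open scoped ENNReal NNReal ContDiff

noncomputable section

namespace Rothe

/-- Lebesgue measure on the time interval `(0,T)`; `L^p(0,T;E)` is `Lp E p (timeMeasure T)`. -/
abbrev timeMeasure (T : ℝ) : Measure ℝ := volume.restrict (Set.Ioo 0 T)

section Abstract

variable {X : Type*} [NormedAddCommGroup X] [NormedSpace ℝ X]

/-- Reflexivity of a real normed space: the canonical map into the bidual is onto. -/
def IsReflexive (X : Type*) [NormedAddCommGroup X] [NormedSpace ℝ X] : Prop :=
  Function.Surjective (NormedSpace.inclusionInDoubleDual ℝ X)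

/-- Weak convergence of a sequence in a normed space. -/
def WeakTendsto (v : ℕ → X) (w : X) : Prop :=
  ∀ φ : StrongDual ℝ X, Tendsto (fun n => φ (v n)) atTop (𝓝 (φ w))

/-- Clarke's generalized directional derivative `j⁰(x;z)`, as an extended real number. -/
def clarkeDeriv (j : X → ℝ) (x z : X) : EReal :=
  limsup (fun q : X × ℝ => (((j (q.1 + q.2 • z) - j q.1) / q.2 : ℝ) : EReal))
    (𝓝 x ×ˢ 𝓝[>] (0 : ℝ))

/-- Clarke's generalized gradient `∂j(x)`. -/
def clarkeGradient (j : X → ℝ) (x : X) : Set (StrongDual ℝ X) :=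
  {ξ | ∀ y : X, ((ξ y : ℝ) : EReal) ≤ clarkeDeriv j x y}

/-- Pseudomonotonicity of a multivalued operator `X → 2^{X*}`. -/
structure IsPseudomonotone (A : X → Set (StrongDual ℝ X)) : Prop where
  nonempty : ∀ v, (A v).Nonempty
  convex : ∀ v, Convex ℝ (A v)
  weaklyCompact : ∀ v, IsCompact (toWeakSpace ℝ (StrongDual ℝ X) '' A v)
  /-- upper semicontinuity from each finite dimensional subspace into `X*` with its weak topology -/
  usc : ∀ F : Submodule ℝ X, FiniteDimensional ℝ F →
    UpperHemicontinuous (fun x : F => toWeakSpace ℝ (StrongDual ℝ X) '' A (x : X))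
  limit : ∀ (v : ℕ → X) (w : X) (s : ℕ → StrongDual ℝ X),
    WeakTendsto v w → (∀ n, s n ∈ A (v n)) →
    limsup (fun n => ((s n (v n - w) : ℝ) : EReal)) atTop ≤ 0 →
    ∀ y : X, ∃ r ∈ A w,
      ((r (w - y) : ℝ) : EReal) ≤ liminf (fun n => ((s n (v n - y) : ℝ) : EReal)) atTop

end Abstract

section Bochner

variable {E : Type*} [NormedAddCommGroup E] [NormedSpace ℝ E]

/-- Functions `v n` all belong to `L²(0,T;E)` and converge weakly in that space to `w`. -/
def WeakTendstoL2 (T : ℝ) (v : ℕ → ℝ → E) (w : Lp E 2 (timeMeasure T)) : Prop :=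
  ∃ h : ∀ n, MemLp (v n) 2 (timeMeasure T), WeakTendsto (fun n => (h n).toLp (v n)) w

/-- Strong convergence of functions `v n` to `w` in `L²(0,T;E)`. -/
def StrongTendstoL2 (T : ℝ) (v : ℕ → ℝ → E) (w : Lp E 2 (timeMeasure T)) : Prop :=
  ∃ h : ∀ n, MemLp (v n) 2 (timeMeasure T), Tendsto (fun n => (h n).toLp (v n)) atTop (𝓝 w)

/-- Weak-* convergence in `L^∞(0,T;H)`, the dual of `L¹(0,T;H)`. -/
def WeakStarTendstoLinfty {H : Type*} [NormedAddCommGroup H] [InnerProductSpace ℝ H]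
    (T : ℝ) (v : ℕ → ℝ → H) (w : ℝ → H) : Prop :=
  (∀ n, MemLp (v n) ∞ (timeMeasure T)) ∧ MemLp w ∞ (timeMeasure T) ∧
    ∀ g : Lp H 1 (timeMeasure T),
      Tendsto (fun n => ∫ t, inner ℝ (v n t) (g t) ∂(timeMeasure T)) atTop
        (𝓝 (∫ t, inner ℝ (w t) (g t) ∂(timeMeasure T)))

/-- The quantity `‖x‖²_{BV²(0,T;E)}`: the supremum over all partitions `0 = t₀ < ⋯ < t_m = T` of
`∑ ‖x(t_{j+1}) - x(t_j)‖²`. -/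
def sqVariation (T : ℝ) (x : ℝ → E) : ℝ≥0∞ :=
  ⨆ (m : ℕ) (t : ℕ → ℝ) (_ : t 0 = 0 ∧ t m = T ∧ ∀ j < m, t j < t (j + 1)),
    ∑ j ∈ Finset.range m, ‖x (t (j + 1)) - x (t j)‖ₑ ^ 2

end Bochner

section Triple

variable {V H U : Type*} [NormedAddCommGroup V] [NormedSpace ℝ V]
  [NormedAddCommGroup H] [InnerProductSpace ℝ H] [NormedAddCommGroup U] [NormedSpace ℝ U]

/-- `V ⊂ H ⊂ V*` is an evolution triple with embedding `i : V → H`: `V` is a separable reflexive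
Banach space, `H` a separable Hilbert space, `i` is injective, continuous, dense and compact. -/
structure IsEvolutionTriple (i : V →L[ℝ] H) : Prop where
  completeV : CompleteSpace V
  reflexiveV : IsReflexive V
  separableV : TopologicalSpace.SeparableSpace V
  completeH : CompleteSpace H
  separableH : TopologicalSpace.SeparableSpace H
  injective : Function.Injective i
  dense : DenseRange i
  compact : IsCompactOperator i

/-- The embedding `V ⊂ H ⊂ V*`, that is `v ↦ (i v, i ·)_H`. -/
def embDual (i : V →L[ℝ] H) (v : V) : StrongDual ℝ V := (innerSL ℝ (i v)).comp i

/-- The norm of `M^{2,2}(0,T;V,V*) = L²(0,T;V) ∩ BV²(0,T;V*)`. -/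
def mNorm (i : V →L[ℝ] H) (T : ℝ) (v : ℝ → V) : ℝ≥0∞ :=
  eLpNorm v 2 (timeMeasure T) + sqVariation T (fun t => embDual i (v t)) ^ (1 / 2 : ℝ)

/-- `v` lies in the closed ball of radius `R` of `M^{2,2}(0,T;V,V*)`. -/
def InMBall (i : V →L[ℝ] H) (T : ℝ) (R : ℝ≥0) (v : ℝ → V) : Prop :=
  AEStronglyMeasurable v (timeMeasure T) ∧ mNorm i T v ≤ R

/-- Assumptions on `A : V → V*`: pseudomonotonicity, linear growth and coercivity. -/
structure HypA (i : V →L[ℝ] H) (A : V → StrongDual ℝ V) (a b α β : ℝ) : Prop where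
  pseudomonotone : IsPseudomonotone (fun v => ({A v} : Set (StrongDual ℝ V)))
  ha : 0 ≤ a
  hb : 0 < b
  growth : ∀ v, ‖A v‖ ≤ a + b * ‖v‖
  hα : 0 < α
  hβ : 0 ≤ β
  coercive : ∀ v, α * ‖v‖ ^ 2 - β * ‖i v‖ ^ 2 ≤ A v v

/-- The monotonicity type relation
`⟨Au - Av, u - v⟩ ≥ m₁ ‖u - v‖² - m₂ ‖u - v‖_H²` with some `m₁ ≥ 0` and `m₂ > 0`. -/
def MonotoneType (i : V →L[ℝ] H) (A : V → StrongDual ℝ V) : Prop :=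
  ∃ m₁ m₂ : ℝ, 0 ≤ m₁ ∧ 0 < m₂ ∧
    ∀ u v : V, m₁ * ‖u - v‖ ^ 2 - m₂ * ‖i (u - v)‖ ^ 2 ≤ (A u - A v) (u - v)

/-- The Nemytskii operator of `A` is of class `(S₊)` with respect to `M^{2,2}(0,T;V,V*)`. -/
def NemytskiiSPlus (i : V →L[ℝ] H) (T : ℝ) (A : V → StrongDual ℝ V) : Prop :=
  ∀ (v : ℕ → ℝ → V) (w : Lp V 2 (timeMeasure T)),
    WeakTendstoL2 T v w → (∃ R : ℝ≥0, ∀ n, InMBall i T R (v n)) →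
    limsup (fun n => ((∫ t, A (v n t) (v n t - w t) ∂(timeMeasure T) : ℝ) : EReal)) atTop ≤ 0 →
    StrongTendstoL2 T v w

/-- Assumptions on `J : U → ℝ`: local Lipschitz continuity and linear growth of `∂J`. -/
structure HypJ (J : U → ℝ) (c : ℝ) : Prop where
  locallyLipschitz : LocallyLipschitz J
  hc : 0 < c
  growth : ∀ (u : U), ∀ ξ ∈ clarkeGradient J u, ‖ξ‖ ≤ c * (1 + ‖u‖)

/-- Assumptions on `ι : V → U`: compactness of `ι` and of its Nemytskii mapping
`M^{2,2}(0,T;V,V*) → L²(0,T;U)`. -/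
structure HypU (i : V →L[ℝ] H) (T : ℝ) (ι : V →L[ℝ] U) : Prop where
  compact : IsCompactOperator ι
  nemytskii : ∀ R : ℝ≥0, IsCompact (closure
    {w : Lp U 2 (timeMeasure T) |
      ∃ v : ℝ → V, InMBall i T R v ∧ ⇑w =ᵐ[timeMeasure T] fun t => ι (v t)})

/-- The auxiliary assumption: one of three alternatives. -/
def HypAux (i : V →L[ℝ] H) (ι : V →L[ℝ] U) (J : U → ℝ) (α c : ℝ) : Prop :=
  (∃ p : H →L[ℝ] U, ∀ v : V, p (i v) = ι v) ∨
  (c * ‖ι‖ ^ 2 < α) ∨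
  (∃ d σ : ℝ, 0 ≤ d ∧ 1 ≤ σ ∧ σ < 2 ∧
    ∀ u : U, clarkeDeriv J u (-u) ≤ ((d * (1 + ‖u‖ ^ σ) : ℝ) : EReal))

end Triple

section Scheme

variable {V H U : Type*} [NormedAddCommGroup V] [NormedSpace ℝ V]
  [NormedAddCommGroup H] [InnerProductSpace ℝ H] [NormedAddCommGroup U] [NormedSpace ℝ U]

/-- Piecewise constant interpolant: the value is `x k` for `t ∈ ((k-1)τ, kτ]`, and `x 0` at `0`. -/
def pwConst {E : Type*} (τ : ℝ) (x : ℕ → E) (t : ℝ) : E := x ⌈t / τ⌉₊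

/-- Piecewise linear interpolant:
the value is `(t/τ - k + 1) x k + (k - t/τ) x (k-1)` for `t ∈ ((k-1)τ, kτ]`, and `x 0` at `0`. -/
def pwLinear {E : Type*} [AddCommGroup E] [Module ℝ E] (τ : ℝ) (x : ℕ → E) (t : ℝ) : E :=
  (t / τ - (⌈t / τ⌉₊ : ℝ) + 1) • x ⌈t / τ⌉₊ + ((⌈t / τ⌉₊ : ℝ) - t / τ) • x (⌈t / τ⌉₊ - 1)

/-- Derivative of the piecewise linear interpolant:
the value is `(x k - x (k-1)) / τ` for `t ∈ ((k-1)τ, kτ]`. -/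
def pwSlope {E : Type*} [AddCommGroup E] [Module ℝ E] (τ : ℝ) (x : ℕ → E) (t : ℝ) : E :=
  τ⁻¹ • (x ⌈t / τ⌉₊ - x (⌈t / τ⌉₊ - 1))

/-- The values `F n k` (`1 ≤ k ≤ N n`) are obtained from `f` by mollification with parameter
`ε n → 0` that is not asymptotically smaller than the time step, followed by sampling at the nodes
`k τ n`. -/
def IsMollifiedSource (T : ℝ) (τ : ℕ → ℝ) (N : ℕ → ℕ)
    (f : Lp (StrongDual ℝ V) 2 (timeMeasure T)) (F : ℕ → ℕ → StrongDual ℝ V) : Prop :=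
  ∃ (ε : ℕ → ℝ) (ρ : ℕ → ℝ → ℝ) (C : ℝ),
    (∀ n, 0 < ε n) ∧ Tendsto ε atTop (𝓝 0) ∧ (∀ n, τ n ≤ C * ε n) ∧
    (∀ n, ContDiff ℝ ∞ (ρ n)) ∧ (∀ n x, 0 ≤ ρ n x) ∧
    (∀ n, tsupport (ρ n) ⊆ Set.Icc (-ε n) (ε n)) ∧ (∀ n, ∫ x, ρ n x = 1) ∧
    (∀ n x, ε n * ρ n x ≤ C) ∧
    ∀ n k, 1 ≤ k → k ≤ N n →
      F n k = ∫ s, ρ n (k * τ n + ε n * ((T - 2 * (k * τ n)) / T) - s) • f s ∂(timeMeasure T)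

/-- Admissible approximations of the source term: mollification and sampling as above, or any other
values whose piecewise constant interpolants converge to `f` strongly in `L²(0,T;V*)`. -/
def IsSourceApprox (T : ℝ) (τ : ℕ → ℝ) (N : ℕ → ℕ)
    (f : Lp (StrongDual ℝ V) 2 (timeMeasure T)) (F : ℕ → ℕ → StrongDual ℝ V) : Prop :=
  IsMollifiedSource T τ N f F ∨ StrongTendstoL2 T (fun n => pwConst (τ n) (F n)) f

/-- The sequence `x 0, …, x N` solves the Rothe problem (implicit Euler scheme) with step `τ`,
source values `F 1, …, F N` and initial value `x₀`. -/
def IsRotheSolution (i : V →L[ℝ] H) (ι : V →L[ℝ] U) (A : V → StrongDual ℝ V) (J : U → ℝ)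
    (τ : ℝ) (N : ℕ) (F : ℕ → StrongDual ℝ V) (x₀ : V) (x : ℕ → V) : Prop :=
  x 0 = x₀ ∧ ∀ k, 1 ≤ k → k ≤ N → ∃ ξ ∈ clarkeGradient J (ι (x k)), ∀ v : V,
    inner ℝ (i (τ⁻¹ • (x k - x (k - 1)))) (i v) + A (x k) v + ξ (ι v) = F k v

/-- `w n → u` strongly in `C([0,T];H)`: the class `u` has a continuous representative on `[0,T]`
and `w n` converges to it uniformly on `[0,T]`. -/
def TendstoC (T : ℝ) (w : ℕ → ℝ → H) (u : ℝ → H) : Prop :=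
  ∃ ũ : ℝ → H, ContinuousOn ũ (Set.Icc 0 T) ∧ ũ =ᵐ[timeMeasure T] u ∧
    (∀ n, ContinuousOn (w n) (Set.Icc 0 T)) ∧ TendstoUniformlyOn w ũ atTop (Set.Icc 0 T)

end Scheme

end Rothe

end

/-!
Everything is derived from the differences of two members of the sequence; neither the equation
solved by the limit nor the integration by parts formula for functions with values in `V` and
derivative in `V*` is needed. Write `ū_n`, `u_n` for the piecewise constant and piecewise linear
interpolants, so that `ū_n - u_n = (kτ - t) u_n'` on the `k`-th cell.

*Compactness.* Weakly convergent sequences are bounded. The identity for `ū_n - u_n` gives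
`‖ū_n - u_n‖_H² ≤ τ ‖u_n'‖_{V*} ‖ū_n - u_n‖_V`, so both interpolants have the same weak limit
(`gap_tendsto_and_limit_eq`). The bound on `u_n'` in `L²(0,T;V*)` bounds the variation of `ū_n`
(`inMBall_pwConst`), whence `ι ū_n → ι u` strongly (`trace_tendsto`), while the selections from the
Clarke gradient stay bounded. Mollified sources converge strongly because the error is an average
of the oscillation of `f` over a strip around the diagonal
(`strongTendstoL2_of_isMollifiedSource`).

*Energy.* The functions `u_n - u_m` are piecewise linear, so the increment of `‖u_n - u_m‖_H²`
is the integral of `2 ⟨u_n' - u_m', u_n - u_m⟩` (`norm_pwLinear_sub_sq`). Since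
`⟨u_n', ū_n - u_n⟩ ≥ 0`, replacing `u_n - u_m` by `ū_n - ū_m`, where the scheme can be used, costs
only the mixed terms `⟨u_n', ū_m - u_m⟩` and `⟨u_m', ū_n - u_n⟩`. These are products of two weakly convergent sequences
and need not vanish jointly; but they do vanish, uniformly with respect to the interval of
integration, if `m → ∞` first and `n → ∞` afterwards (`eventually_forall_abs_setIntegral_le`).

*Uniform convergence.* Under the monotonicity type relation, Gronwall's inequality turns this into
`limsup_n limsup_m sup_t ‖u_n(t) - u_m(t)‖_H = 0`, which already implies the uniform Cauchy property
(`ConvergentScheme.tendstoC`).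

*The `(S₊)` condition.* The energy identity at time `T` gives a lower bound for
`∫ ⟨u_n', u_n⟩ + ∫ ⟨u_m', u_m⟩`; choosing both indices along a minimizing subsequence yields
`liminf ∫ ⟨u_n', u_n - u⟩ ≥ 0`. Testing the scheme with `ū_n - u` then shows
`limsup ∫ ⟨A ū_n, ū_n - u⟩ ≤ 0` (`ConvergentScheme.limsup_integral_le`).
-/

noncomputable section

namespace Rothe

/-! ### The pairing of `L²` functions -/

section Pairing

variable {α : Type*} {m : MeasurableSpace α} {μ : Measure α}
  {E F : Type*} [NormedAddCommGroup E] [NormedAddCommGroup F]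

lemma lpNorm_le_of_norm_le {f : α → E} {g : α → F} {p : ℝ≥0∞} (hf : AEStronglyMeasurable f μ)
    (hg : MemLp g p μ) (h : ∀ᵐ t ∂μ, ‖f t‖ ≤ ‖g t‖) : lpNorm f p μ ≤ lpNorm g p μ := by
  rw [← toReal_eLpNorm hf, ← toReal_eLpNorm hg.1]
  exact ENNReal.toReal_mono hg.eLpNorm_ne_top (eLpNorm_mono_ae h)

lemma lpNorm_congr_of_ae_eq {f g : α → E} {p : ℝ≥0∞} (h : f =ᵐ[μ] g) :
    lpNorm f p μ = lpNorm g p μ := by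
  rw [lpNorm, lpNorm, eLpNorm_congr_ae h, propext (aestronglyMeasurable_congr h)]

lemma integrable_norm_mul_norm {g : α → E} {v : α → F} (hg : MemLp g 2 μ) (hv : MemLp v 2 μ) :
    Integrable (fun t => ‖g t‖ * ‖v t‖) μ :=
  MemLp.integrable_mul hg.norm hv.norm

lemma integral_norm_mul_norm_le {g : α → E} {v : α → F} (hg : MemLp g 2 μ) (hv : MemLp v 2 μ) :
    ∫ t, ‖g t‖ * ‖v t‖ ∂μ ≤ lpNorm g 2 μ * lpNorm v 2 μ := by
  have h1 := eLpNorm_le_eLpNorm_mul_eLpNorm'_of_norm (p := 2) (q := 2) (r := 1) hg.norm.1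
    hv.norm.1 (fun x y : ℝ => x * y) 1 (by simp)
  have h2 := (integrable_norm_mul_norm hg hv)
  rw [ENNReal.coe_one, one_mul, eLpNorm_norm, eLpNorm_norm] at h1
  have h3 := ENNReal.toReal_mono (ENNReal.mul_ne_top hg.eLpNorm_ne_top hv.eLpNorm_ne_top) h1
  rw [ENNReal.toReal_mul, toReal_eLpNorm hg.1, toReal_eLpNorm hv.1, toReal_eLpNorm h2.1,
    lpNorm_one_eq_integral_norm h2.1] at h3
  simpa using h3

lemma norm_toLp_eq_lpNorm {g : α → E} (hg : MemLp g 2 μ) : ‖hg.toLp g‖ = lpNorm g 2 μ := by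
  rw [Lp.norm_toLp, toReal_eLpNorm hg.1]

lemma integral_norm_sq_eq {g : α → E} (hg : MemLp g 2 μ) :
    ∫ t, ‖g t‖ ^ 2 ∂μ = lpNorm g 2 μ ^ 2 := by
  rw [lpNorm_eq_integral_norm_rpow_toReal (by simp) (by simp) hg.1]
  have h0 : 0 ≤ ∫ t, ‖g t‖ ^ 2 ∂μ := integral_nonneg fun t => by positivity
  have : ∫ t, ‖g t‖ ^ (2 : ℝ≥0∞).toReal ∂μ = ∫ t, ‖g t‖ ^ 2 ∂μ := by simp
  rw [this, ← Real.rpow_natCast, ← Real.rpow_mul h0]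
  simp

variable [NormedSpace ℝ E] [NormedSpace ℝ F] (B : E →L[ℝ] F →L[ℝ] ℝ)

lemma integrable_pairing {g : α → E} {v : α → F} (hg : MemLp g 2 μ) (hv : MemLp v 2 μ) :
    Integrable (fun t => B (g t) (v t)) μ :=
  memLp_one_iff_integrable.1 (B.memLp_of_bilin 1 hg hv)

lemma abs_integral_pairing_le {g : α → E} {v : α → F} (hg : MemLp g 2 μ) (hv : MemLp v 2 μ) :
    |∫ t, B (g t) (v t) ∂μ| ≤ ‖B‖ * (lpNorm g 2 μ * lpNorm v 2 μ) := by
  calc |∫ t, B (g t) (v t) ∂μ| ≤ ∫ t, ‖B‖ * (‖g t‖ * ‖v t‖) ∂μ := by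
        rw [← Real.norm_eq_abs]
        refine norm_integral_le_of_norm_le
          ((integrable_norm_mul_norm (E := E) (F := F) hg hv).const_mul ‖B‖)
          (.of_forall fun t => ?_)
        rw [← mul_assoc]
        exact B.le_opNorm₂ (g t) (v t)
    _ ≤ _ := by
        rw [integral_const_mul]
        exact mul_le_mul_of_nonneg_left (integral_norm_mul_norm_le hg hv) (norm_nonneg B)

end Pairing

/-! ### Weak convergence in `L²(0,T;E)` -/

section Weak

/-- The uniform boundedness principle for weakly convergent sequences. -/
lemma WeakTendsto.exists_norm_le {X : Type*} [NormedAddCommGroup X] [NormedSpace ℝ X]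
    {v : ℕ → X} {w : X} (h : WeakTendsto v w) : ∃ M, ∀ n, ‖v n‖ ≤ M := by
  obtain ⟨M, hM⟩ := banach_steinhaus
    (g := fun n => NormedSpace.inclusionInDoubleDual ℝ X (v n)) fun φ => by
      obtain ⟨M, hM⟩ := (h φ).norm.bddAbove_range
      exact ⟨M, fun n => hM ⟨n, rfl⟩⟩
  exact ⟨M, fun n => by
    rw [← (NormedSpace.inclusionInDoubleDualLi (E := X) ℝ).norm_map (v n)]
    exact hM n⟩

lemma WeakTendsto.map {X Y : Type*} [NormedAddCommGroup X] [NormedSpace ℝ X]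
    [NormedAddCommGroup Y] [NormedSpace ℝ Y] {v : ℕ → X} {w : X} (h : WeakTendsto v w)
    (L : X →L[ℝ] Y) : WeakTendsto (fun n => L (v n)) (L w) :=
  fun φ => h (φ.comp L)

lemma WeakTendsto.unique {X : Type*} [NormedAddCommGroup X] [NormedSpace ℝ X]
    {v : ℕ → X} {w w' : X} (h : WeakTendsto v w) (h' : WeakTendsto v w') : w = w' := by
  refine (SeparatingDual.eq_iff_forall_dual_eq (R := ℝ)).2 fun φ => ?_
  exact tendsto_nhds_unique (h φ) (h' φ)

lemma weakTendsto_of_tendsto {X : Type*} [NormedAddCommGroup X] [NormedSpace ℝ X]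
    {v : ℕ → X} {w : X} (h : Tendsto v atTop (𝓝 w)) : WeakTendsto v w :=
  fun φ => (φ.continuous.tendsto w).comp h

/-- A weakly convergent sequence in a relatively compact set converges in norm. -/
lemma WeakTendsto.tendsto_of_isCompact {X : Type*} [NormedAddCommGroup X] [NormedSpace ℝ X]
    {v : ℕ → X} {w : X} (h : WeakTendsto v w) {K : Set X} (hK : IsCompact K)
    (hv : ∀ n, v n ∈ K) : Tendsto v atTop (𝓝 w) := by
  refine tendsto_of_subseq_tendsto fun ns hns => ?_
  obtain ⟨z, -, φ, hφ, hz⟩ := hK.tendsto_subseq (x := fun n => v (ns n)) fun n => hv _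
  refine ⟨φ, ?_⟩
  have h1 : WeakTendsto (fun n => v (ns (φ n))) w :=
    fun ψ => (h ψ).comp (hns.comp hφ.tendsto_atTop)
  rw [h1.unique (weakTendsto_of_tendsto hz)]
  exact hz

variable {T : ℝ} {E F : Type*} [NormedAddCommGroup E] [NormedSpace ℝ E] [NormedAddCommGroup F]
  [NormedSpace ℝ F]

lemma WeakTendstoL2.memLp {v : ℕ → ℝ → E} {w : Lp E 2 (timeMeasure T)}
    (h : WeakTendstoL2 T v w) (n : ℕ) : MemLp (v n) 2 (timeMeasure T) := h.1 n

lemma WeakTendstoL2.exists_lpNorm_le {v : ℕ → ℝ → E} {w : Lp E 2 (timeMeasure T)}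
    (h : WeakTendstoL2 T v w) : ∃ M, 0 ≤ M ∧ ∀ n, lpNorm (v n) 2 (timeMeasure T) ≤ M := by
  obtain ⟨h1, h2⟩ := h
  obtain ⟨M, hM⟩ := h2.exists_norm_le
  exact ⟨M, (norm_nonneg _).trans (hM 0), fun n => by
    simpa [norm_toLp_eq_lpNorm (h1 n)] using hM n⟩

/-- Testing a weakly convergent sequence with a fixed `L²` function. -/
lemma WeakTendstoL2.tendsto_integral {v : ℕ → ℝ → F} {w : Lp F 2 (timeMeasure T)}
    (h : WeakTendstoL2 T v w) (B : E →L[ℝ] F →L[ℝ] ℝ) {g : ℝ → E}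
    (hg : MemLp g 2 (timeMeasure T)) :
    Tendsto (fun n => ∫ t, B (g t) (v n t) ∂(timeMeasure T)) atTop
      (𝓝 (∫ t, B (g t) (w t) ∂(timeMeasure T))) := by
  obtain ⟨h1, h2⟩ := h
  have h3 := h2 (B.lpPairing (timeMeasure T) 2 2 (hg.toLp g))
  have h4 : ∫ t, B (g t) (w t) ∂(timeMeasure T) =
      B.lpPairing (timeMeasure T) 2 2 (hg.toLp g) w := by
    rw [ContinuousLinearMap.lpPairing_eq_integral]
    refine integral_congr_ae ?_
    filter_upwards [hg.coeFn_toLp] with t ht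
    rw [ht]
  rw [h4]
  refine h3.congr fun n => ?_
  rw [ContinuousLinearMap.lpPairing_eq_integral]
  refine integral_congr_ae ?_
  filter_upwards [hg.coeFn_toLp, (h1 n).coeFn_toLp] with t ht ht'
  rw [ht, ht']

lemma WeakTendstoL2.map {v : ℕ → ℝ → E} {w : Lp E 2 (timeMeasure T)}
    (h : WeakTendstoL2 T v w) (L : E →L[ℝ] F) :
    WeakTendstoL2 T (fun n t => L (v n t)) (L.compLpL 2 (timeMeasure T) w) := by
  obtain ⟨h1, h2⟩ := h
  refine ⟨fun n => L.comp_memLp' (h1 n), ?_⟩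
  have h3 := h2.map (L.compLpL 2 (timeMeasure T))
  convert h3 using 2 with n
  ext1
  refine (MemLp.coeFn_toLp _).trans ?_
  refine EventuallyEq.trans ?_ (L.coeFn_compLpL _).symm
  filter_upwards [(h1 n).coeFn_toLp] with t ht
  rw [ht]

lemma WeakTendstoL2.sub {v v' : ℕ → ℝ → E} {w w' : Lp E 2 (timeMeasure T)}
    (h : WeakTendstoL2 T v w) (h' : WeakTendstoL2 T v' w') :
    WeakTendstoL2 T (fun n t => v n t - v' n t) (w - w') := by
  refine ⟨fun n => (h.1 n).sub (h'.1 n), fun φ => ?_⟩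
  have := (h.2 φ).sub (h'.2 φ)
  rw [map_sub]
  refine this.congr fun n => ?_
  rw [← map_sub]
  rfl

/-- Convergence in `L²(0,T;E)` from convergence of the norms of the differences. -/
lemma strongTendstoL2_iff {E : Type*} [NormedAddCommGroup E] {v : ℕ → ℝ → E}
    {w : Lp E 2 (timeMeasure T)}
    (h : ∀ n, MemLp (v n) 2 (timeMeasure T)) :
    StrongTendstoL2 T v w ↔
      Tendsto (fun n => lpNorm (fun t => v n t - w t) 2 (timeMeasure T)) atTop (𝓝 0) := by
  have key : ∀ n, ‖(h n).toLp (v n) - w‖ = lpNorm (fun t => v n t - w t) 2 (timeMeasure T) := by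
    intro n
    have hw := Lp.memLp w
    have : (h n).toLp (v n) - w = ((h n).sub hw).toLp _ := by
      rw [MemLp.toLp_sub (h n) hw, Lp.toLp_coeFn w hw]
    rw [this, norm_toLp_eq_lpNorm]
    rfl
  constructor
  · rintro ⟨h1, h2⟩
    rw [tendsto_iff_norm_sub_tendsto_zero] at h2
    exact h2.congr key
  · intro h2
    refine ⟨h, ?_⟩
    rw [tendsto_iff_norm_sub_tendsto_zero]
    exact h2.congr fun n => (key n).symm

lemma StrongTendstoL2.weakTendstoL2 {v : ℕ → ℝ → E} {w : Lp E 2 (timeMeasure T)}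
    (h : StrongTendstoL2 T v w) : WeakTendstoL2 T v w :=
  ⟨h.1, weakTendsto_of_tendsto h.2⟩

/-- If `v m → 0` weakly in `L²`, the integrals over `(0,s)` of the pairing with a fixed `L²`
function tend to zero uniformly in `s`: on a fine grid there are only finitely many integrals, and
between grid points absolute continuity of `∫ ‖g‖²` controls the change. -/
lemma eventually_forall_abs_setIntegral_le (B : E →L[ℝ] F →L[ℝ] ℝ) {g : ℝ → E}
    (hg : MemLp g 2 (timeMeasure T)) {v : ℕ → ℝ → F} (hv : WeakTendstoL2 T v 0)
    {ε : ℝ} (hε : 0 < ε) :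
    ∀ᶠ m in atTop, ∀ s ∈ Set.Icc 0 T,
      |∫ t in Set.Iic s, B (g t) (v m t) ∂(timeMeasure T)| ≤ ε := by
  obtain ⟨M, hM0, hM⟩ := hv.exists_lpNorm_le
  -- `‖B‖ η M ≤ ε / 2`: an `L²` norm `η` of `g` between grid points changes the integral by `ε / 2`
  set η : ℝ := ε / 2 / (‖B‖ * M + 1) with hη
  have hη0 : 0 < η := by positivity
  obtain ⟨δ, hδ, hgδ⟩ := hg.eLpNorm_indicator_le (by norm_num) (by norm_num) hη0
  have hgrid : ∀ᶠ m in atTop, ∀ k ∈ Finset.range (⌊T / δ⌋₊ + 1),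
      |∫ t in Set.Iic (k * δ), B (g t) (v m t) ∂(timeMeasure T)| ≤ ε / 2 := by
    rw [eventually_all_finset]
    intro k _
    have h1 := hv.tendsto_integral B (hg.indicator (measurableSet_Iic (a := (k : ℝ) * δ)))
    have h2 : ∫ t, B ((Set.Iic (k * δ)).indicator g t) ((0 : Lp F 2 (timeMeasure T)) t)
        ∂(timeMeasure T) = 0 := by
      rw [← integral_zero ℝ ℝ (μ := timeMeasure T)]
      refine integral_congr_ae ?_
      filter_upwards [Lp.coeFn_zero F 2 (timeMeasure T)] with t ht
      rw [ht]
      simp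
    rw [h2] at h1
    have h3 := h1.abs.eventually_le_const (u := ε / 2) (by simpa using hε)
    filter_upwards [h3] with m hm
    refine le_trans (le_of_eq ?_) hm
    rw [← integral_indicator measurableSet_Iic]
    congr 2
    ext t
    by_cases ht : t ∈ Set.Iic (k * δ) <;> simp [Set.indicator, ht]
  filter_upwards [hgrid] with m hm s hs
  set k := ⌊s / δ⌋₊ with hk
  have hkδ : k * δ ≤ s := (le_div_iff₀ hδ).1 (Nat.floor_le (div_nonneg hs.1 hδ.le))
  have hsδ : s < (k + 1) * δ := (div_lt_iff₀ hδ).1 (Nat.lt_floor_add_one _)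
  have hkK : k ∈ Finset.range (⌊T / δ⌋₊ + 1) := by
    rw [Finset.mem_range, Nat.lt_succ_iff]
    exact Nat.floor_le_floor (by gcongr; exact hs.2)
  have hint : Integrable (fun t => B (g t) (v m t)) (timeMeasure T) :=
    integrable_pairing B hg (hv.memLp m)
  have hsplit : Set.Iic s = Set.Iic (k * δ) ∪ Set.Ioc (k * δ) s := (Set.Iic_union_Ioc_eq_Iic hkδ).symm
  rw [hsplit, setIntegral_union (Set.Iic_disjoint_Ioc le_rfl) measurableSet_Ioc
    hint.integrableOn hint.integrableOn]
  have hsmall : |∫ t in Set.Ioc (k * δ) s, B (g t) (v m t) ∂(timeMeasure T)| ≤ ε / 2 := by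
    have h1 : ∫ t in Set.Ioc (k * δ) s, B (g t) (v m t) ∂(timeMeasure T) =
        ∫ t, B ((Set.Ioc (k * δ) s).indicator g t) (v m t) ∂(timeMeasure T) := by
      rw [← integral_indicator measurableSet_Ioc]
      congr 1
      ext t
      by_cases ht : t ∈ Set.Ioc (k * δ) s
      · simp only [Set.indicator, ht, if_true]
      · simp only [Set.indicator, ht, if_false, map_zero, zero_apply]
    rw [h1]
    refine (abs_integral_pairing_le B (hg.indicator measurableSet_Ioc) (hv.memLp m)).trans ?_
    have h2 : lpNorm ((Set.Ioc (k * δ) s).indicator g) 2 (timeMeasure T) ≤ η := by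
      rw [← toReal_eLpNorm (hg.indicator measurableSet_Ioc).1]
      refine ENNReal.toReal_le_of_le_ofReal hη0.le (hgδ _ measurableSet_Ioc ?_)
      refine (Measure.restrict_apply_le _ _).trans ?_
      rw [Real.volume_Ioc]
      exact ENNReal.ofReal_le_ofReal (by linarith)
    have h3 : ‖B‖ * (η * M) ≤ ε / 2 := by
      have : (‖B‖ * M + 1) * η = ε / 2 := by rw [hη]; field_simp
      nlinarith
    refine le_trans ?_ h3
    gcongr
    · exact lpNorm_nonneg
    · exact hM m
  calc _ ≤ _ := abs_add_le _ _
    _ ≤ ε / 2 + ε / 2 := add_le_add (hm k hkK) hsmall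
    _ = ε := by ring

end Weak

/-! ### Step functions and piecewise linear functions on a uniform grid -/

section Steps

variable {T τ : ℝ} {N : ℕ} {E : Type*} [NormedAddCommGroup E]

lemma ceil_div_mem (hτ : 0 < τ) (hN : N * τ = T) {t : ℝ} (ht : t ∈ Set.Ioc 0 T) :
    1 ≤ ⌈t / τ⌉₊ ∧ ⌈t / τ⌉₊ ≤ N := by
  refine ⟨Nat.one_le_ceil_iff.2 (div_pos ht.1 hτ), Nat.ceil_le.2 ?_⟩
  rw [div_le_iff₀ hτ, hN]
  exact ht.2

lemma ceil_mul_sub_mem (hτ : 0 < τ) {t : ℝ} (ht : 0 ≤ t) :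
    0 ≤ ⌈t / τ⌉₊ * τ - t ∧ ⌈t / τ⌉₊ * τ - t ≤ τ := by
  have h1 := Nat.le_ceil (t / τ)
  have h2 := Nat.ceil_lt_add_one (div_nonneg ht hτ.le)
  rw [div_le_iff₀ hτ] at h1
  have h3 : (⌈t / τ⌉₊ : ℝ) * τ ≤ (t / τ + 1) * τ := by gcongr
  have h4 : (t / τ + 1) * τ = t + τ := by field_simp
  constructor <;> linarith

lemma ceil_div_eq (hτ : 0 < τ) {k : ℕ} {t : ℝ} (h1 : k * τ < t) (h2 : t ≤ (k + 1) * τ) :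
    ⌈t / τ⌉₊ = k + 1 := by
  rw [Nat.ceil_eq_iff (Nat.succ_ne_zero k)]
  constructor
  · rw [lt_div_iff₀ hτ]; simpa using h1
  · rw [div_le_iff₀ hτ]; exact_mod_cast h2

lemma stronglyMeasurable_pwConst (y : ℕ → E) : StronglyMeasurable (pwConst τ y) :=
  (StronglyMeasurable.of_discrete (f := y)).comp_measurable
    (Nat.measurable_ceil.comp (measurable_id.div_const τ))

lemma memLp_pwConst (hτ : 0 < τ) (hN : N * τ = T) (y : ℕ → E) (p : ℝ≥0∞) :
    MemLp (pwConst τ y) p (timeMeasure T) := by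
  refine MemLp.of_bound (stronglyMeasurable_pwConst y).aestronglyMeasurable
    (∑ k ∈ Finset.range (N + 1), ‖y k‖) ?_
  filter_upwards [ae_restrict_mem measurableSet_Ioo] with t ht
  have := (ceil_div_mem hτ hN (Set.Ioo_subset_Ioc_self ht)).2
  exact Finset.single_le_sum (f := fun k => ‖y k‖) (fun _ _ => norm_nonneg _)
    (Finset.mem_range.2 (Nat.lt_succ_of_le this))

lemma integral_timeMeasure_Iic {s : ℝ} (hs : s ∈ Set.Icc 0 T) (h : ℝ → ℝ) :
    ∫ t in Set.Iic s, h t ∂(timeMeasure T) = ∫ t in (0 : ℝ)..s, h t := by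
  rw [intervalIntegral.integral_of_le hs.1, timeMeasure, Measure.restrict_restrict measurableSet_Iic]
  refine setIntegral_congr_set ?_
  have h1 : (Set.Iic s ∩ Set.Ioo 0 T : Set ℝ) =ᵐ[volume] (Set.Iic s ∩ Set.Ioc 0 T : Set ℝ) :=
    EventuallyEq.inter (EventuallyEq.refl _ _) Ioo_ae_eq_Ioc
  have h2 : Set.Iic s ∩ Set.Ioc 0 T = Set.Ioc 0 s := by
    ext t
    exact ⟨fun h => ⟨h.2.1, h.1⟩, fun h => ⟨h.2, h.1, h.2.trans hs.2⟩⟩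
  rwa [h2] at h1

lemma integral_timeMeasure (hT : 0 ≤ T) (h : ℝ → ℝ) :
    ∫ t, h t ∂(timeMeasure T) = ∫ t in (0 : ℝ)..T, h t := by
  rw [intervalIntegral.integral_of_le hT, timeMeasure]
  exact setIntegral_congr_set Ioo_ae_eq_Ioc

lemma intervalIntegrable_of_integrable {h : ℝ → ℝ} (hh : Integrable h (timeMeasure T))
    {a b : ℝ} (hab : a ≤ b) (ha : 0 ≤ a) (hb : b ≤ T) : IntervalIntegrable h volume a b := by
  rw [intervalIntegrable_iff_integrableOn_Ioo_of_le hab]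
  exact IntegrableOn.mono_set hh (Set.Ioo_subset_Ioo ha hb)

lemma integral_pwConst (hτ : 0 < τ) (hN : N * τ = T) (y : ℕ → ℝ) :
    ∫ t, pwConst τ y t ∂(timeMeasure T) = τ * ∑ k ∈ Finset.range N, y (k + 1) := by
  have hT : 0 ≤ T := by rw [← hN]; positivity
  have hint := (memLp_one_iff_integrable.1 (memLp_pwConst hτ hN y 1))
  rw [integral_timeMeasure hT]
  have h1 := intervalIntegral.sum_integral_adjacent_intervals (f := pwConst τ y) (μ := volume)
    (a := fun k : ℕ => (k : ℝ) * τ) (n := N) fun k hk => by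
      refine intervalIntegrable_of_integrable hint (by gcongr; simp) (by positivity) ?_
      rw [← hN]; gcongr; exact hk
  simp only [Nat.cast_zero, zero_mul, hN] at h1
  rw [← h1, Finset.mul_sum]
  refine Finset.sum_congr rfl fun k _ => ?_
  have hle : (k : ℝ) * τ ≤ ((k + 1 : ℕ) : ℝ) * τ := by gcongr; simp
  rw [intervalIntegral.integral_congr_ae (g := fun _ => y (k + 1)), intervalIntegral.integral_const]
  · push_cast; rw [smul_eq_mul]; ring
  · refine .of_forall fun t ht => ?_
    rw [Set.uIoc_of_le hle] at ht
    rw [pwConst, ceil_div_eq hτ ht.1 (by exact_mod_cast ht.2)]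

/-- The increment over `b - a ≤ N` grid cells is at most `N` times the sum of the squared increments
over the single cells. -/
lemma norm_sub_sq_le_sum (x : ℕ → E) {a b : ℕ} (hab : a ≤ b) (hb : b ≤ N) :
    ‖x b - x a‖ ^ 2 ≤ N * (∑ k ∈ Finset.range b, ‖x (k + 1) - x k‖ ^ 2 -
      ∑ k ∈ Finset.range a, ‖x (k + 1) - x k‖ ^ 2) := by
  rw [← Finset.sum_Ico_eq_sub _ hab, ← Finset.sum_Ico_sub _ hab]
  calc ‖∑ k ∈ Finset.Ico a b, (x (k + 1) - x k)‖ ^ 2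
      ≤ (∑ k ∈ Finset.Ico a b, ‖x (k + 1) - x k‖) ^ 2 := by gcongr; exact norm_sum_le _ _
    _ ≤ (Finset.Ico a b).card * ∑ k ∈ Finset.Ico a b, ‖x (k + 1) - x k‖ ^ 2 :=
        sq_sum_le_card_mul_sum_sq
    _ ≤ _ := by
        gcongr
        rw [Nat.card_Ico]
        omega

lemma sqVariation_pwConst_le (hτ : 0 < τ) (hN : N * τ = T) (x : ℕ → E) :
    sqVariation T (pwConst τ x) ≤
      ENNReal.ofReal (N * ∑ k ∈ Finset.range N, ‖x (k + 1) - x k‖ ^ 2) := by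
  set S : ℕ → ℝ := fun b => ∑ k ∈ Finset.range b, ‖x (k + 1) - x k‖ ^ 2 with hS
  refine iSup_le fun m => iSup_le fun t => iSup_le fun ⟨h0, hm, hlt⟩ => ?_
  have hle : ∀ j ≤ m, t j ≤ T := by
    intro j hj
    rw [← hm]
    induction hj using Nat.decreasingInduction with
    | self => exact le_rfl
    | of_succ k hk ih => exact (hlt k hk).le.trans ih
  have hκ : ∀ j ≤ m, ⌈t j / τ⌉₊ ≤ N := fun j hj => by
    refine Nat.ceil_le.2 ?_
    rw [div_le_iff₀ hτ, hN]
    exact hle j hj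
  have hterm : ∀ j ∈ Finset.range m, ‖pwConst τ x (t (j + 1)) - pwConst τ x (t j)‖ₑ ^ 2 ≤
      ENNReal.ofReal (N * (S ⌈t (j + 1) / τ⌉₊ - S ⌈t j / τ⌉₊)) := by
    intro j hj
    have hj := Finset.mem_range.1 hj
    rw [← ofReal_norm, ← ENNReal.ofReal_pow (norm_nonneg _)]
    refine ENNReal.ofReal_le_ofReal (norm_sub_sq_le_sum x (Nat.ceil_le_ceil ?_) (hκ _ hj))
    have := hlt j hj
    gcongr
  refine (Finset.sum_le_sum hterm).trans ?_
  rw [← ENNReal.ofReal_sum_of_nonneg, ← Finset.mul_sum,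
    Finset.sum_range_sub (fun j => S ⌈t j / τ⌉₊)]
  · refine ENNReal.ofReal_le_ofReal ?_
    rw [h0, hm, ← hN, mul_div_cancel_right₀ _ hτ.ne']
    simp [hS]
  · intro j hj
    have := hlt j (Finset.mem_range.1 hj)
    refine mul_nonneg (Nat.cast_nonneg _) (sub_nonneg.2 ?_)
    refine Finset.sum_le_sum_of_subset_of_nonneg (Finset.range_mono (Nat.ceil_le_ceil ?_))
      fun _ _ _ => by positivity
    gcongr

variable [NormedSpace ℝ E]

lemma memLp_pwSlope (hτ : 0 < τ) (hN : N * τ = T) (x : ℕ → E) (p : ℝ≥0∞) :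
    MemLp (pwSlope τ x) p (timeMeasure T) :=
  memLp_pwConst hτ hN (fun k => τ⁻¹ • (x k - x (k - 1))) p

lemma pwConst_sub_pwLinear (hτ : 0 < τ) (x : ℕ → E) (t : ℝ) :
    pwConst τ x t - pwLinear τ x t = (⌈t / τ⌉₊ * τ - t) • pwSlope τ x t := by
  have h : (⌈t / τ⌉₊ * τ - t) * τ⁻¹ = ⌈t / τ⌉₊ - t / τ := by field_simp
  rw [pwSlope, smul_smul, h, pwConst, pwLinear]
  module

lemma pwLinear_eq_affine (hτ : 0 < τ) (x : ℕ → E) {k : ℕ} {t : ℝ}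
    (ht : t ∈ Set.Icc (k * τ) ((k + 1) * τ)) :
    pwLinear τ x t = x k + (t - k * τ) • τ⁻¹ • (x (k + 1) - x k) := by
  rcases ht.1.eq_or_lt with h | h
  · rw [← h, pwLinear, mul_div_cancel_right₀ _ hτ.ne', Nat.ceil_natCast]
    simp
  · have h1 : (t - k * τ) * τ⁻¹ = t / τ - k := by field_simp
    rw [pwLinear, ceil_div_eq hτ h ht.2, smul_smul, h1, Nat.add_sub_cancel]
    push_cast
    module

lemma pwLinear_zero (x : ℕ → E) : pwLinear τ x 0 = x 0 := by simp [pwLinear]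

lemma continuousOn_pwLinear (hτ : 0 < τ) (hN : N * τ = T) (x : ℕ → E) :
    ContinuousOn (pwLinear τ x) (Set.Icc 0 T) := by
  rw [← hN]
  clear hN
  induction N with
  | zero => simp
  | succ k ih =>
    have h1 : (0 : ℝ) ≤ k * τ := by positivity
    have h2 : (k : ℝ) * τ ≤ ((k + 1 : ℕ) : ℝ) * τ := by gcongr; simp
    rw [← Set.Icc_union_Icc_eq_Icc h1 h2]
    refine ih.union_of_isClosed ?_ isClosed_Icc isClosed_Icc
    have h3 : ContinuousOn (fun t => x k + (t - k * τ) • τ⁻¹ • (x (k + 1) - x k))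
        (Set.Icc (k * τ) ((k + 1 : ℕ) * τ)) := by fun_prop
    refine h3.congr fun t ht => pwLinear_eq_affine hτ x (by exact_mod_cast ht)

lemma hasDerivAt_pwLinear (hτ : 0 < τ) (x : ℕ → E) {t : ℝ} (ht : 0 < t)
    (ht' : ∀ k : ℕ, t ≠ k * τ) : HasDerivAt (pwLinear τ x) (pwSlope τ x t) t := by
  obtain ⟨k, hk⟩ : ∃ k, ⌈t / τ⌉₊ = k + 1 :=
    Nat.exists_eq_succ_of_ne_zero (Nat.ceil_pos.2 (div_pos ht hτ)).ne'
  have h := (Nat.ceil_eq_iff (Nat.succ_ne_zero k)).1 hk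
  have h1 : k * τ < t := by have := (lt_div_iff₀ hτ).1 h.1; simpa using this
  have h2 : t < (k + 1) * τ := by
    refine lt_of_le_of_ne ?_ (by exact_mod_cast ht' (k + 1))
    have := (div_le_iff₀ hτ).1 h.2
    exact_mod_cast this
  have h3 : HasDerivAt (fun t => x k + (t - k * τ) • τ⁻¹ • (x (k + 1) - x k))
      (pwSlope τ x t) t := by
    rw [pwSlope, hk, Nat.add_sub_cancel]
    simpa using (((hasDerivAt_id t).sub_const (k * τ)).smul_const
      (τ⁻¹ • (x (k + 1) - x k))).const_add (x k)
  refine h3.congr_of_eventuallyEq ?_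
  filter_upwards [Ioo_mem_nhds h1 h2] with r hr
  exact pwLinear_eq_affine hτ x (Set.Ioo_subset_Icc_self hr)

lemma lpNorm_pwSlope_sq (hτ : 0 < τ) (hN : N * τ = T) (x : ℕ → E) :
    T * lpNorm (pwSlope τ x) 2 (timeMeasure T) ^ 2 =
      N * ∑ k ∈ Finset.range N, ‖x (k + 1) - x k‖ ^ 2 := by
  rw [← integral_norm_sq_eq (memLp_pwSlope hτ hN x 2)]
  have h1 : (fun t => ‖pwSlope τ x t‖ ^ 2) =
      pwConst τ (fun k => (τ ^ 2)⁻¹ * ‖x k - x (k - 1)‖ ^ 2) := by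
    ext t
    rw [pwSlope, pwConst, norm_smul, mul_pow, norm_inv, inv_pow, Real.norm_of_nonneg hτ.le]
  rw [h1, integral_pwConst hτ hN, ← hN, ← Finset.mul_sum]
  simp only [Nat.add_sub_cancel]
  field_simp

end Steps

/-! ### The evolution triple -/

section Triple

variable {T : ℝ} {V H : Type*} [NormedAddCommGroup V] [NormedSpace ℝ V] [NormedAddCommGroup H]
  [InnerProductSpace ℝ H] (i : V →L[ℝ] H)

@[simp] lemma embDual_apply (v w : V) : embDual i v w = inner ℝ (i v) (i w) := rfl

/-- `v ↦ (i v, i ·)_H` as a continuous linear map `V → V*`. -/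
def embDualL : V →L[ℝ] StrongDual ℝ V :=
  ((ContinuousLinearMap.compL ℝ V H ℝ).flip i).comp ((innerSL ℝ).comp i)

@[simp] lemma embDualL_apply (v : V) : embDualL i v = embDual i v := rfl

lemma embDual_pwSlope (τ : ℝ) (x : ℕ → V) (t : ℝ) :
    embDual i (pwSlope τ x t) = pwSlope τ (fun k => embDual i (x k)) t := by
  simp only [← embDualL_apply, pwSlope, map_smul, map_sub]

/-- The piecewise constant interpolants are bounded in `M^{2,2}` by the norms of `ū` in `L²(0,T;V)`
and of `u'` in `L²(0,T;V*)`. -/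
lemma inMBall_pwConst {τ : ℝ} {N : ℕ} (hτ : 0 < τ) (hN : N * τ = T) (x : ℕ → V) {M M' : ℝ}
    (hM : lpNorm (pwConst τ x) 2 (timeMeasure T) ≤ M)
    (hM' : lpNorm (fun t => embDual i (pwSlope τ x t)) 2 (timeMeasure T) ≤ M') :
    InMBall i T (M + √T * M').toNNReal (pwConst τ x) := by
  have hT : 0 ≤ T := by rw [← hN]; positivity
  have hmem := memLp_pwConst hτ hN x 2
  refine ⟨hmem.1, ?_⟩
  have h1 : (fun t => embDual i (pwConst τ x t)) = pwConst τ (fun k => embDual i (x k)) := rfl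
  have h0 : 0 ≤ lpNorm (pwConst τ x) 2 (timeMeasure T) := lpNorm_nonneg
  have h0' : 0 ≤ lpNorm (fun t => embDual i (pwSlope τ x t)) 2 (timeMeasure T) := lpNorm_nonneg
  rw [mNorm, ← ofReal_lpNorm hmem, h1]
  change _ ≤ ENNReal.ofReal _
  rw [ENNReal.ofReal_add (h0.trans hM) (mul_nonneg (Real.sqrt_nonneg _) (h0'.trans hM'))]
  refine add_le_add (ENNReal.ofReal_le_ofReal hM) ?_
  have h2 := sqVariation_pwConst_le hτ hN (fun k => embDual i (x k))
  rw [← lpNorm_pwSlope_sq hτ hN (fun k => embDual i (x k))] at h2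
  simp_rw [embDual_pwSlope] at hM' h0'
  refine (ENNReal.rpow_le_rpow h2 (by norm_num)).trans ?_
  rw [ENNReal.ofReal_rpow_of_nonneg (by positivity) (by norm_num), ← Real.sqrt_eq_rpow,
    Real.sqrt_mul hT, Real.sqrt_sq h0']
  gcongr

/-- The energy identity for the difference of two piecewise linear interpolants. -/
lemma norm_pwLinear_sub_sq {τ τ' : ℝ} {N N' : ℕ} (hτ : 0 < τ) (hN : N * τ = T) (hτ' : 0 < τ')
    (hN' : N' * τ' = T) (x x' : ℕ → V) {s : ℝ} (hs : s ∈ Set.Icc 0 T)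
    (hx : MemLp (pwLinear τ x) 2 (timeMeasure T)) (hx' : MemLp (pwLinear τ' x') 2 (timeMeasure T)) :
    ‖i (pwLinear τ x s - pwLinear τ' x' s)‖ ^ 2 = ‖i (x 0 - x' 0)‖ ^ 2 +
      2 * ∫ t in Set.Iic s, inner ℝ (i (pwSlope τ x t - pwSlope τ' x' t))
        (i (pwLinear τ x t - pwLinear τ' x' t)) ∂(timeMeasure T) := by
  have hint : Integrable (fun t => inner ℝ (i (pwSlope τ x t - pwSlope τ' x' t))
      (i (pwLinear τ x t - pwLinear τ' x' t))) (timeMeasure T) := by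
    have h1 : MemLp (fun t => pwSlope τ x t - pwSlope τ' x' t) 2 (timeMeasure T) :=
      (memLp_pwSlope hτ hN x 2).sub (memLp_pwSlope hτ' hN' x' 2)
    exact integrable_pairing (innerSL ℝ) (i.comp_memLp' h1) (i.comp_memLp' (hx.sub hx'))
  rw [integral_timeMeasure_Iic hs]
  have h := MeasureTheory.integral_eq_of_hasDerivAt_off_countable_of_le
    (fun t => ‖i (pwLinear τ x t - pwLinear τ' x' t)‖ ^ 2)
    (fun t => 2 * inner ℝ (i (pwSlope τ x t - pwSlope τ' x' t))
      (i (pwLinear τ x t - pwLinear τ' x' t))) hs.1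
    (s := Set.range (fun k : ℕ => (k : ℝ) * τ) ∪ Set.range (fun k : ℕ => (k : ℝ) * τ'))
    ((Set.countable_range _).union (Set.countable_range _)) ?_ ?_ ?_
  · rw [intervalIntegral.integral_const_mul] at h
    simp only [pwLinear_zero] at h
    linarith
  · have h1 := (continuousOn_pwLinear hτ hN x).sub (continuousOn_pwLinear hτ' hN' x')
    exact ((i.continuous.comp_continuousOn h1).norm.pow 2).mono (Set.Icc_subset_Icc_right hs.2)
  · rintro t ⟨ht, ht'⟩
    simp only [Set.mem_union, Set.mem_range, not_or, not_exists] at ht'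
    have h1 := (hasDerivAt_pwLinear hτ x ht.1 fun k hk => ht'.1 k hk.symm).sub
      (hasDerivAt_pwLinear hτ' x' ht.1 fun k hk => ht'.2 k hk.symm)
    have h2 := (i.hasFDerivAt.comp_hasDerivAt t h1).norm_sq
    rw [real_inner_comm]
    exact h2
  · exact (intervalIntegrable_of_integrable hint hs.1 le_rfl hs.2).const_mul 2

end Triple

/-! ### Mollified and sampled source terms -/

section Mollification

variable {E : Type*} [NormedAddCommGroup E] [NormedSpace ℝ E]

/-- Jensen's inequality for the average of `f - y` with respect to a probability density `K`. -/
lemma ofReal_norm_integral_smul_sub_sq_le {α : Type*} {m : MeasurableSpace α} {μ : Measure α}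
    [CompleteSpace E] [IsFiniteMeasure μ] {K : α → ℝ} {c : ℝ} (hK : AEStronglyMeasurable K μ)
    (h0 : ∀ s, 0 ≤ K s) (hc : ∀ s, K s ≤ c) (h1 : ∫ s, K s ∂μ = 1) {f : α → E} (hf : MemLp f 2 μ)
    (y : E) :
    ENNReal.ofReal (‖∫ s, K s • f s ∂μ - y‖ ^ 2) ≤
      ∫⁻ s, ENNReal.ofReal (K s * ‖f s - y‖ ^ 2) ∂μ := by
  have hKb : ∀ᵐ s ∂μ, ‖K s‖ ≤ c := .of_forall fun s => by
    rw [Real.norm_of_nonneg (h0 s)]; exact hc s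
  have hKi : Integrable K μ := Integrable.of_bound hK c hKb
  have hfy : MemLp (fun s => f s - y) 2 μ := hf.sub (memLp_const y)
  have hd : MemLp (fun s => ‖f s - y‖) 2 μ := hfy.norm
  have hi1 : Integrable (fun s => K s * ‖f s - y‖) μ :=
    (hd.integrable (by norm_num)).bdd_mul hK hKb
  have hi2 : Integrable (fun s => K s * ‖f s - y‖ ^ 2) μ := hd.integrable_sq.bdd_mul hK hKb
  set a := ∫ s, K s * ‖f s - y‖ ∂μ with ha
  have hle : ‖∫ s, K s • f s ∂μ - y‖ ≤ a := by
    have : ∫ s, K s • f s ∂μ - y = ∫ s, K s • (f s - y) ∂μ := by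
      have hi3 : Integrable (fun s => K s • f s) μ :=
        (hf.integrable (by norm_num)).bdd_smul c hK hKb
      simp_rw [smul_sub]
      rw [integral_sub hi3 (hKi.smul_const y), integral_smul_const, h1, one_smul]
    rw [this]
    refine (norm_integral_le_integral_norm _).trans (le_of_eq ?_)
    refine integral_congr_ae (.of_forall fun s => ?_)
    simp [norm_smul, abs_of_nonneg (h0 s)]
  -- the variance of `‖f - y‖` under the density `K` is nonnegative
  have hvar : 0 ≤ ∫ s, K s * (‖f s - y‖ - a) ^ 2 ∂μ :=
    integral_nonneg fun s => mul_nonneg (h0 s) (sq_nonneg _)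
  have hexp : ∫ s, K s * (‖f s - y‖ - a) ^ 2 ∂μ = ∫ s, K s * ‖f s - y‖ ^ 2 ∂μ - a ^ 2 := by
    have : ∀ s, K s * (‖f s - y‖ - a) ^ 2 =
        K s * ‖f s - y‖ ^ 2 - 2 * a * (K s * ‖f s - y‖) + a ^ 2 * K s := fun s => by ring
    simp_rw [this]
    have hi3 : Integrable (fun s => K s * ‖f s - y‖ ^ 2 - 2 * a * (K s * ‖f s - y‖)) μ :=
      hi2.sub (hi1.const_mul _)
    rw [integral_add hi3 (hKi.const_mul _), integral_sub hi2 (hi1.const_mul _), integral_const_mul,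
      integral_const_mul, h1, ← ha]
    ring
  rw [← ofReal_integral_eq_lintegral_ofReal hi2
    (.of_forall fun s => mul_nonneg (h0 s) (sq_nonneg _))]
  refine ENNReal.ofReal_le_ofReal ?_
  have : ‖∫ s, K s • f s ∂μ - y‖ ^ 2 ≤ a ^ 2 := by gcongr
  linarith

/-- The indicator of the strip `|s - t| ≤ δ` around the diagonal. -/
def strip (δ t s : ℝ) : ℝ≥0∞ := if |s - t| ≤ δ then 1 else 0

lemma measurable_strip (δ : ℝ) : Measurable fun p : ℝ × ℝ => strip δ p.1 p.2 :=
  Measurable.ite (measurableSet_le (by fun_prop) measurable_const) measurable_const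
    measurable_const

lemma lintegral_strip_le (T δ t : ℝ) :
    ∫⁻ s, strip δ t s ∂(timeMeasure T) ≤ ENNReal.ofReal (2 * δ) := by
  have h : (fun s => strip δ t s) = (Metric.closedBall t δ).indicator 1 := by
    ext s
    simp [strip, Set.indicator, Real.dist_eq]
  rw [h, lintegral_indicator_one Metric.isClosed_closedBall.measurableSet, ← Real.volume_closedBall]
  exact Measure.restrict_apply_le _ _

/-- The mean oscillation of an `L²` function over the strip of width `δ` is `o(δ)`. -/
lemma exists_lintegral_strip_le {T : ℝ} (hT : 0 ≤ T) {f : ℝ → E} (hfm : StronglyMeasurable f)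
    (hf : MemLp f 2 (timeMeasure T)) {η : ℝ} (hη : 0 < η) :
    ∃ δ₀ > 0, ∀ δ, 0 ≤ δ → δ < δ₀ →
      ∫⁻ t, ∫⁻ s, strip δ t s * ENNReal.ofReal (‖f s - f t‖ ^ 2) ∂(timeMeasure T)
        ∂(timeMeasure T) ≤ ENNReal.ofReal (δ * η) := by
  set μ := timeMeasure T with hμ
  -- splitting `f s - f t` through a continuous `g` with both errors at most `r` gives the bound
  -- `3 (2 δ r² + 2 δ (T r² + r²)) = δ η`
  set r : ℝ := √(η / (6 * (2 + T))) with hr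
  have hr0 : 0 < r := by positivity
  have hr2 : r ^ 2 * (6 * (2 + T)) = η := by
    rw [hr, Real.sq_sqrt (by positivity)]; field_simp
  obtain ⟨g, hgs, hfg, hgc, hg⟩ := hf.exists_hasCompactSupport_eLpNorm_sub_le
    (by norm_num) (ENNReal.ofReal_pos.2 hr0).ne'
  obtain ⟨δ₀, hδ₀, hgu⟩ := Metric.uniformContinuous_iff.1
    (hgs.uniformContinuous_of_continuous hgc) r hr0
  refine ⟨δ₀, hδ₀, fun δ hδ hδδ => ?_⟩
  set φ : ℝ → ℝ≥0∞ := fun t => ENNReal.ofReal (‖f t - g t‖ ^ 2) with hφ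
  have hφm : Measurable φ := by
    have := (hfm.sub hgc.stronglyMeasurable).norm.measurable
    exact (this.pow_const 2).ennreal_ofReal
  have hfgm : MemLp (fun t => f t - g t) 2 μ := hf.sub hg
  have hφi : ∫⁻ t, φ t ∂μ ≤ ENNReal.ofReal (r ^ 2) := by
    rw [← ofReal_integral_eq_lintegral_ofReal hfgm.norm.integrable_sq
      (.of_forall fun t => sq_nonneg _), integral_norm_sq_eq hfgm]
    refine ENNReal.ofReal_le_ofReal ?_
    gcongr
    · exact lpNorm_nonneg
    · rw [← toReal_eLpNorm hfgm.1]
      exact ENNReal.toReal_le_of_le_ofReal hr0.le hfg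
  have hpt : ∀ t s, strip δ t s * ENNReal.ofReal (‖f s - f t‖ ^ 2) ≤
      3 * (strip δ t s * φ s + strip δ t s * (ENNReal.ofReal (r ^ 2) + φ t)) := by
    intro t s
    by_cases h : |s - t| ≤ δ
    · simp only [strip, h, if_true, one_mul, hφ]
      rw [← ENNReal.ofReal_add (by positivity) (by positivity),
        ← ENNReal.ofReal_add (by positivity) (by positivity),
        show (3 : ℝ≥0∞) = ENNReal.ofReal 3 by simp, ← ENNReal.ofReal_mul (by norm_num)]
      refine ENNReal.ofReal_le_ofReal ?_
      have h1 : ‖g s - g t‖ ≤ r := by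
        rw [← dist_eq_norm]
        exact (hgu (by rw [Real.dist_eq]; linarith)).le
      have h2 : ‖f s - f t‖ ≤ ‖f s - g s‖ + ‖g s - g t‖ + ‖f t - g t‖ := by
        rw [norm_sub_rev (f t) (g t)]
        refine le_trans (le_of_eq ?_) (norm_add₃_le)
        congr 1
        abel
      have h3 : ‖f s - f t‖ ≤ ‖f s - g s‖ + r + ‖f t - g t‖ := by linarith
      calc ‖f s - f t‖ ^ 2 ≤ (‖f s - g s‖ + r + ‖f t - g t‖) ^ 2 := by gcongr
        _ ≤ _ := by
          nlinarith [sq_nonneg (‖f s - g s‖ - r), sq_nonneg (‖f s - g s‖ - ‖f t - g t‖),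
            sq_nonneg (r - ‖f t - g t‖)]
    · simp [strip, h]
  have hsm : ∀ t, Measurable (strip δ t) := fun t => (measurable_strip δ).comp measurable_prodMk_left
  have hA : ∫⁻ t, ∫⁻ s, strip δ t s * φ s ∂μ ∂μ ≤ ENNReal.ofReal (2 * δ * r ^ 2) := by
    rw [lintegral_lintegral_swap
      (((measurable_strip δ).mul (hφm.comp measurable_snd)).aemeasurable)]
    calc ∫⁻ s, ∫⁻ t, strip δ t s * φ s ∂μ ∂μ ≤ ∫⁻ s, ENNReal.ofReal (2 * δ) * φ s ∂μ := by
          refine lintegral_mono fun s => ?_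
          have hsymm : ∀ t, strip δ t s = strip δ s t := fun t => by
            simp only [strip, abs_sub_comm]
          simp_rw [hsymm]
          rw [lintegral_mul_const _ (hsm s)]
          gcongr
          exact lintegral_strip_le T δ s
      _ ≤ _ := by
          rw [lintegral_const_mul _ hφm, ENNReal.ofReal_mul (p := 2 * δ) (by positivity)]
          exact mul_le_mul' le_rfl hφi
  have hB : ∫⁻ t, ∫⁻ s, strip δ t s * (ENNReal.ofReal (r ^ 2) + φ t) ∂μ ∂μ ≤
      ENNReal.ofReal (2 * δ * (T * r ^ 2 + r ^ 2)) := by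
    calc ∫⁻ t, ∫⁻ s, strip δ t s * (ENNReal.ofReal (r ^ 2) + φ t) ∂μ ∂μ
        ≤ ∫⁻ t, ENNReal.ofReal (2 * δ) * (ENNReal.ofReal (r ^ 2) + φ t) ∂μ := by
          refine lintegral_mono fun t => ?_
          rw [lintegral_mul_const _ (hsm t)]
          gcongr
          exact lintegral_strip_le T δ t
      _ ≤ _ := by
          rw [lintegral_const_mul _ (by fun_prop), lintegral_add_right _ hφm, lintegral_const,
            ENNReal.ofReal_mul (p := 2 * δ) (by positivity), ENNReal.ofReal_add (by positivity) (by positivity),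
            mul_comm T, ENNReal.ofReal_mul (sq_nonneg r)]
          gcongr
          simp [hμ]
  calc ∫⁻ t, ∫⁻ s, strip δ t s * ENNReal.ofReal (‖f s - f t‖ ^ 2) ∂μ ∂μ
      ≤ ∫⁻ t, ∫⁻ s, 3 * (strip δ t s * φ s + strip δ t s * (ENNReal.ofReal (r ^ 2) + φ t)) ∂μ ∂μ :=
        lintegral_mono fun t => lintegral_mono fun s => hpt t s
    _ = 3 * (∫⁻ t, ∫⁻ s, strip δ t s * φ s ∂μ ∂μ +
          ∫⁻ t, ∫⁻ s, strip δ t s * (ENNReal.ofReal (r ^ 2) + φ t) ∂μ ∂μ) := by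
        have hm : Measurable fun p : ℝ × ℝ => strip δ p.1 p.2 * φ p.2 :=
          (measurable_strip δ).mul (hφm.comp measurable_snd)
        have h1 : ∀ t, ∫⁻ s, 3 * (strip δ t s * φ s + strip δ t s * (ENNReal.ofReal (r ^ 2) + φ t)) ∂μ
            = 3 * (∫⁻ s, strip δ t s * φ s ∂μ +
              ∫⁻ s, strip δ t s * (ENNReal.ofReal (r ^ 2) + φ t) ∂μ) := by
          intro t
          have hm' : Measurable fun s => strip δ t s * φ s := (hsm t).mul hφm
          rw [lintegral_const_mul' _ _ (by norm_num), lintegral_add_left hm']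
        simp_rw [h1]
        rw [lintegral_const_mul' _ _ (by norm_num), lintegral_add_left hm.lintegral_prod_right']
    _ ≤ 3 * (ENNReal.ofReal (2 * δ * r ^ 2) + ENNReal.ofReal (2 * δ * (T * r ^ 2 + r ^ 2))) := by
        gcongr
    _ = ENNReal.ofReal (δ * η) := by
        rw [← ENNReal.ofReal_add (by positivity) (by positivity),
          show (3 : ℝ≥0∞) = ENNReal.ofReal 3 by simp, ← ENNReal.ofReal_mul (by norm_num), ← hr2]
        congr 1
        ring

/-- The mollification kernel is a probability density on `(0,T)`: the affine change of variables
keeps its support inside `[0,T]`. -/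
lemma integral_mollifier {T ε r : ℝ} (hT : 0 < T) (hεT : ε ≤ T / 2) {ρ : ℝ → ℝ}
    (hsupp : tsupport ρ ⊆ Set.Icc (-ε) ε) (h1 : ∫ x, ρ x = 1) (hr : r ∈ Set.Icc 0 T) :
    ∫ s, ρ (r + ε * ((T - 2 * r) / T) - s) ∂(timeMeasure T) = 1 := by
  set θ := r + ε * ((T - 2 * r) / T) with hθ
  have hθ1 : θ - ε = r * (1 - 2 * ε / T) := by rw [hθ]; field_simp; ring
  have hθ2 : T - (θ + ε) = (T - r) * (1 - 2 * ε / T) := by rw [hθ]; field_simp; ring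
  have hpos : 0 ≤ 1 - 2 * ε / T := by
    rw [sub_nonneg, div_le_one hT]; linarith
  have h2 : 0 ≤ θ - ε := by rw [hθ1]; exact mul_nonneg hr.1 hpos
  have h3 : 0 ≤ T - (θ + ε) := by rw [hθ2]; exact mul_nonneg (sub_nonneg.2 hr.2) hpos
  rw [timeMeasure, ← integral_Icc_eq_integral_Ioo, setIntegral_eq_integral_of_forall_compl_eq_zero,
    integral_sub_left_eq_self ρ volume θ, h1]
  intro s hs
  by_contra hne
  have := hsupp (subset_tsupport ρ hne)
  exact hs ⟨by linarith [this.2], by linarith [this.1]⟩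

/-- Mollified and sampled sources converge strongly: the error at time `t` is an average of
`f s - f t` over `|s - t| ≤ (2 + C) ε` with a density bounded by `C / ε`. -/
lemma strongTendstoL2_of_isMollifiedSource {V : Type*} [NormedAddCommGroup V] [NormedSpace ℝ V]
    {T : ℝ} (hT : 0 < T) {τ : ℕ → ℝ} {N : ℕ → ℕ} (hτ : ∀ n, 0 < τ n) (hN : ∀ n, N n * τ n = T)
    {f : Lp (StrongDual ℝ V) 2 (timeMeasure T)} {F : ℕ → ℕ → StrongDual ℝ V}
    (hF : IsMollifiedSource T τ N f F) : StrongTendstoL2 T (fun n => pwConst (τ n) (F n)) f := by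
  obtain ⟨ε, ρ, C, hε, hε0, hτε, hρs, hρ0, hsupp, hρ1, hρC, hF⟩ := hF
  have hC : 0 < C := pos_of_mul_pos_left ((hτ 0).trans_le (hτε 0)) (hε 0).le
  have hmem : ∀ n, MemLp (pwConst (τ n) (F n)) 2 (timeMeasure T) :=
    fun n => memLp_pwConst (hτ n) (hN n) _ 2
  rw [strongTendstoL2_iff hmem, Metric.tendsto_atTop']
  intro κ hκ
  obtain ⟨δ₀, hδ₀, hstrip⟩ := exists_lintegral_strip_le hT.le
    (Lp.stronglyMeasurable f) (Lp.memLp f)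
    (η := (κ / 2) ^ 2 / (C * (2 + C))) (by positivity)
  have hev : ∀ᶠ n in atTop, ε n ≤ T / 2 ∧ (2 + C) * ε n < δ₀ := by
    refine (hε0.eventually_le_const (by positivity)).and ?_
    have := hε0.const_mul (2 + C)
    rw [mul_zero] at this
    exact this.eventually_lt_const hδ₀
  obtain ⟨n₀, hn₀⟩ := eventually_atTop.1 hev
  refine ⟨n₀, fun n hn => ?_⟩
  obtain ⟨hεT, hεδ⟩ := hn₀ n hn.le
  have hεn := hε n
  have hτn := hτ n
  have hpt : ∀ t ∈ Set.Ioo 0 T, ENNReal.ofReal (‖pwConst (τ n) (F n) t - f t‖ ^ 2) ≤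
      ENNReal.ofReal (C / ε n) * ∫⁻ s, strip ((2 + C) * ε n) t s *
        ENNReal.ofReal (‖f s - f t‖ ^ 2) ∂(timeMeasure T) := by
    intro t ht
    obtain ⟨hk1, hkN⟩ := ceil_div_mem hτn (hN n) (Set.Ioo_subset_Ioc_self ht)
    have hkt := ceil_mul_sub_mem hτn ht.1.le
    set k := ⌈t / τ n⌉₊ with hk
    have hr : (k * τ n : ℝ) ∈ Set.Icc 0 T := by
      refine ⟨by positivity, ?_⟩
      rw [← hN n]; gcongr
    have hb : ∀ x, ρ n x ≤ C / ε n := fun x => by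
      rw [le_div_iff₀ hεn, mul_comm]; exact hρC n x
    have h1 := ofReal_norm_integral_smul_sub_sq_le (μ := timeMeasure T)
      (K := fun s => ρ n (k * τ n + ε n * ((T - 2 * (k * τ n)) / T) - s)) (c := C / ε n)
      ((hρs n).continuous.comp (by fun_prop)).aestronglyMeasurable
      (fun s => hρ0 n _) (fun s => hb _)
      (integral_mollifier hT hεT (hsupp n) (hρ1 n) hr) (Lp.memLp f) (f t)
    have h2 : pwConst (τ n) (F n) t = F n k := rfl
    rw [h2, hF n k hk1 hkN]
    refine h1.trans ?_
    rw [← lintegral_const_mul' _ _ ENNReal.ofReal_ne_top]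
    refine lintegral_mono fun s => ?_
    rw [ENNReal.ofReal_mul (hρ0 n _), ← mul_assoc (ENNReal.ofReal (C / ε n))]
    refine mul_le_mul' ?_ le_rfl
    by_cases hρ : ρ n (k * τ n + ε n * ((T - 2 * (k * τ n)) / T) - s) = 0
    · rw [hρ]; simp
    · have h3 := hsupp n (subset_tsupport (ρ n) hρ)
      have h4 : |(T - 2 * (k * τ n)) / T| ≤ 1 := by
        rw [abs_le, le_div_iff₀ hT, div_le_iff₀ hT]
        constructor <;> linarith [hr.1, hr.2]
      have h5 := abs_le.1 h4
      have h6 : |s - t| ≤ (2 + C) * ε n := by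
        have := hτε n
        have h7 : ε n * ((T - 2 * (k * τ n)) / T) ≤ ε n * 1 := by gcongr; exact h5.2
        have h8 : ε n * (-1) ≤ ε n * ((T - 2 * (k * τ n)) / T) := by gcongr; exact h5.1
        rw [abs_le]
        constructor <;> nlinarith [h3.1, h3.2, hkt.1, hkt.2]
      simp only [strip, h6, if_true, mul_one]
      exact ENNReal.ofReal_le_ofReal (hb _)
  have hdm : MemLp (fun t => pwConst (τ n) (F n) t - f t) 2 (timeMeasure T) :=
    (hmem n).sub (Lp.memLp f)
  have hsq : ENNReal.ofReal (lpNorm (fun t => pwConst (τ n) (F n) t - f t) 2 (timeMeasure T) ^ 2) ≤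
      ENNReal.ofReal ((κ / 2) ^ 2) := by
    rw [← integral_norm_sq_eq hdm, ofReal_integral_eq_lintegral_ofReal hdm.norm.integrable_sq
      (.of_forall fun t => sq_nonneg _)]
    calc ∫⁻ t, ENNReal.ofReal (‖pwConst (τ n) (F n) t - f t‖ ^ 2) ∂(timeMeasure T)
        ≤ ∫⁻ t, ENNReal.ofReal (C / ε n) * ∫⁻ s, strip ((2 + C) * ε n) t s *
            ENNReal.ofReal (‖f s - f t‖ ^ 2) ∂(timeMeasure T) ∂(timeMeasure T) := by
          refine lintegral_mono_ae ?_
          filter_upwards [ae_restrict_mem measurableSet_Ioo] with t ht using hpt t ht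
      _ ≤ ENNReal.ofReal (C / ε n) * ENNReal.ofReal ((2 + C) * ε n *
            ((κ / 2) ^ 2 / (C * (2 + C)))) := by
          rw [lintegral_const_mul' _ _ ENNReal.ofReal_ne_top]
          gcongr
          exact hstrip _ (by positivity) hεδ
      _ = _ := by
          rw [← ENNReal.ofReal_mul (by positivity)]
          congr 1
          field_simp
  rw [ENNReal.ofReal_le_ofReal_iff (by positivity)] at hsq
  have h0 : 0 ≤ lpNorm (fun t => pwConst (τ n) (F n) t - f t) 2 (timeMeasure T) := lpNorm_nonneg
  rw [Real.dist_eq, sub_zero, abs_of_nonneg h0]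
  linarith [abs_le_of_sq_le_sq' hsq (by positivity)]

lemma IsSourceApprox.strongTendstoL2 {V : Type*} [NormedAddCommGroup V] [NormedSpace ℝ V]
    {T : ℝ} (hT : 0 < T) {τ : ℕ → ℝ} {N : ℕ → ℕ} (hτ : ∀ n, 0 < τ n) (hN : ∀ n, N n * τ n = T)
    {f : Lp (StrongDual ℝ V) 2 (timeMeasure T)} {F : ℕ → ℕ → StrongDual ℝ V}
    (hF : IsSourceApprox T τ N f F) : StrongTendstoL2 T (fun n => pwConst (τ n) (F n)) f :=
  hF.elim (strongTendstoL2_of_isMollifiedSource hT hτ hN) id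

end Mollification

/-! ### Convergence facts shared by both assertions -/

section Limit

variable {T : ℝ} {V H U : Type*} [NormedAddCommGroup V] [NormedSpace ℝ V] [NormedAddCommGroup H]
  [InnerProductSpace ℝ H] [NormedAddCommGroup U] [NormedSpace ℝ U]

lemma WeakTendstoL2.congr_limit {E : Type*} [NormedAddCommGroup E] [NormedSpace ℝ E]
    {v : ℕ → ℝ → E} {w w' : Lp E 2 (timeMeasure T)} (h : WeakTendstoL2 T v w)
    (h' : WeakTendstoL2 T v w') : w = w' :=
  h.2.unique h'.2

lemma weakTendstoL2_const {E : Type*} [NormedAddCommGroup E] [NormedSpace ℝ E]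
    (w : Lp E 2 (timeMeasure T)) : WeakTendstoL2 T (fun _ => w) w :=
  ⟨fun _ => Lp.memLp w, fun φ => by simp⟩

section Gap

variable (i : V →L[ℝ] H) {τ : ℝ} (x : ℕ → V)

/-- Implicit Euler is dissipative: `⟨u', ū - u⟩ = (kτ - t) ‖u'‖_H² ≥ 0`. -/
lemma embDual_pwSlope_gap_nonneg (hτ : 0 < τ) {t : ℝ} (ht : 0 ≤ t) :
    0 ≤ embDual i (pwSlope τ x t) (pwConst τ x t - pwLinear τ x t) := by
  rw [pwConst_sub_pwLinear hτ, map_smul, embDual_apply, real_inner_self_eq_norm_sq]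
  exact mul_nonneg (ceil_mul_sub_mem hτ ht).1 (sq_nonneg _)

/-- Interpolation between `V` and `V*`: since `ū - u = (kτ - t) u'`, the `H`-norm of `ū - u` is
controlled by the step size. -/
lemma norm_gap_sq_le (hτ : 0 < τ) {t : ℝ} (ht : 0 ≤ t) :
    ‖i (pwConst τ x t - pwLinear τ x t)‖ ^ 2 ≤
      τ * (‖embDual i (pwSlope τ x t)‖ * ‖pwConst τ x t - pwLinear τ x t‖) := by
  have h1 : ‖i (pwConst τ x t - pwLinear τ x t)‖ ^ 2 = (⌈t / τ⌉₊ * τ - t) *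
      embDual i (pwSlope τ x t) (pwConst τ x t - pwLinear τ x t) := by
    rw [← real_inner_self_eq_norm_sq]
    nth_rewrite 1 [pwConst_sub_pwLinear hτ]
    rw [map_smul, real_inner_smul_left, embDual_apply]
  obtain ⟨h2, h3⟩ := ceil_mul_sub_mem hτ ht
  rw [h1]
  exact mul_le_mul h3 ((le_abs_self _).trans ((embDual i (pwSlope τ x t)).le_opNorm _))
    (embDual_pwSlope_gap_nonneg i x hτ ht) hτ.le

lemma lpNorm_gap_sq_le {N : ℕ} (hτ : 0 < τ) (hN : N * τ = T)
    (hx : MemLp (pwLinear τ x) 2 (timeMeasure T)) :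
    lpNorm (fun t => i (pwConst τ x t - pwLinear τ x t)) 2 (timeMeasure T) ^ 2 ≤
      τ * (lpNorm (fun t => embDual i (pwSlope τ x t)) 2 (timeMeasure T) *
        lpNorm (fun t => pwConst τ x t - pwLinear τ x t) 2 (timeMeasure T)) := by
  have he : MemLp (fun t => pwConst τ x t - pwLinear τ x t) 2 (timeMeasure T) :=
    (memLp_pwConst hτ hN x 2).sub hx
  have hs : MemLp (fun t => embDual i (pwSlope τ x t)) 2 (timeMeasure T) :=
    (embDualL i).comp_memLp' (memLp_pwSlope hτ hN x 2)
  have hie : MemLp (fun t => i (pwConst τ x t - pwLinear τ x t)) 2 (timeMeasure T) :=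
    i.comp_memLp' he
  rw [← integral_norm_sq_eq hie]
  refine le_trans ?_ (mul_le_mul_of_nonneg_left (integral_norm_mul_norm_le hs he) hτ.le)
  rw [← integral_const_mul]
  refine integral_mono_ae hie.norm.integrable_sq ((integrable_norm_mul_norm hs he).const_mul τ) ?_
  filter_upwards [ae_restrict_mem measurableSet_Ioo] with t ht
  exact norm_gap_sq_le i x hτ ht.1.le

end Gap

/-- The consequences of the a priori estimates on which both assertions rest. Here `ξ n k` is the
element of the Clarke gradient selected at step `k`; the limits of the piecewise constant and of the
piecewise linear interpolants are the same, and all terms except those with `A` and `u'` are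
compact. -/
structure ConvergentScheme (i : V →L[ℝ] H) (ι : V →L[ℝ] U) (A : V → StrongDual ℝ V) (T : ℝ)
    (τ : ℕ → ℝ) (N : ℕ → ℕ) (F : ℕ → ℕ → StrongDual ℝ V) (x : ℕ → ℕ → V)
    (ξ : ℕ → ℕ → StrongDual ℝ U) (f : Lp (StrongDual ℝ V) 2 (timeMeasure T))
    (u : Lp V 2 (timeMeasure T)) (u₂ : Lp (StrongDual ℝ V) 2 (timeMeasure T)) (u₀ : H) : Prop where
  step_pos : ∀ n, 0 < τ n
  grid : ∀ n, N n * τ n = T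
  equation : ∀ n, ∀ t ∈ Set.Ioo 0 T, ∀ v, embDual i (pwSlope (τ n) (x n) t) v +
    A (pwConst (τ n) (x n) t) v + pwConst (τ n) (ξ n) t (ι v) = pwConst (τ n) (F n) t v
  initial : Tendsto (fun n => i (x n 0)) atTop (𝓝 u₀)
  const : WeakTendstoL2 T (fun n => pwConst (τ n) (x n)) u
  linear : WeakTendstoL2 T (fun n => pwLinear (τ n) (x n)) u
  deriv : WeakTendstoL2 T (fun n t => embDual i (pwSlope (τ n) (x n) t)) u₂
  gap : Tendsto (fun n => lpNorm (fun t => i (pwConst (τ n) (x n) t - pwLinear (τ n) (x n) t)) 2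
    (timeMeasure T)) atTop (𝓝 0)
  trace : Tendsto (fun n => lpNorm (fun t => ι (pwConst (τ n) (x n) t) - ι (u t)) 2
    (timeMeasure T)) atTop (𝓝 0)
  reaction : ∃ M, 0 ≤ M ∧ ∀ n, lpNorm (pwConst (τ n) (ξ n)) 2 (timeMeasure T) ≤ M
  source : Tendsto (fun n => lpNorm (fun t => pwConst (τ n) (F n) t - f t) 2
    (timeMeasure T)) atTop (𝓝 0)

/-- Both interpolants have the same weak limit, because their difference tends to zero strongly in
`L²(0,T;H)` and `i` is injective. -/
lemma gap_tendsto_and_limit_eq {i : V →L[ℝ] H} (hi : Function.Injective i) {τ : ℕ → ℝ} {N : ℕ → ℕ}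
    (hτpos : ∀ n, 0 < τ n) (hN : ∀ n, N n * τ n = T) (hτ : Tendsto τ atTop (𝓝 0)) {x : ℕ → ℕ → V}
    {u u₁ : Lp V 2 (timeMeasure T)} {u₂ : Lp (StrongDual ℝ V) 2 (timeMeasure T)}
    (hconst : WeakTendstoL2 T (fun n => pwConst (τ n) (x n)) u)
    (hlin : WeakTendstoL2 T (fun n => pwLinear (τ n) (x n)) u₁)
    (hderiv : WeakTendstoL2 T (fun n t => embDual i (pwSlope (τ n) (x n) t)) u₂) :
    Tendsto (fun n => lpNorm (fun t => i (pwConst (τ n) (x n) t - pwLinear (τ n) (x n) t)) 2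
      (timeMeasure T)) atTop (𝓝 0) ∧ u₁ = u := by
  have he := hconst.sub hlin
  obtain ⟨M, hM0, hM⟩ := he.exists_lpNorm_le
  obtain ⟨M', hM0', hM'⟩ := hderiv.exists_lpNorm_le
  have hgap : Tendsto (fun n => lpNorm (fun t => i (pwConst (τ n) (x n) t - pwLinear (τ n) (x n) t))
      2 (timeMeasure T)) atTop (𝓝 0) := by
    have h1 : Tendsto (fun n => √(τ n * (M' * M))) atTop (𝓝 0) := by
      have := (hτ.mul_const (M' * M)).sqrt
      simpa using this
    refine squeeze_zero (fun n => lpNorm_nonneg) (fun n => ?_) h1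
    refine Real.le_sqrt_of_sq_le ((lpNorm_gap_sq_le i (x n) (hτpos n) (hN n) (hlin.memLp n)).trans ?_)
    have := (hτpos n).le
    gcongr
    · exact lpNorm_nonneg
    · exact hM' n
    · exact hM n
  refine ⟨hgap, ?_⟩
  have h1 := he.map i
  have h2 : StrongTendstoL2 T (fun n t => i (pwConst (τ n) (x n) t - pwLinear (τ n) (x n) t)) 0 := by
    rw [strongTendstoL2_iff h1.memLp]
    refine hgap.congr fun n => ?_
    refine lpNorm_congr_of_ae_eq ?_
    filter_upwards [Lp.coeFn_zero H 2 (timeMeasure T)] with t ht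
    rw [ht, Pi.zero_apply, sub_zero]
  have h3 := h1.congr_limit h2.weakTendstoL2
  have h4 : u - u₁ = 0 := by
    rw [Lp.eq_zero_iff_ae_eq_zero]
    rw [Lp.eq_zero_iff_ae_eq_zero] at h3
    filter_upwards [h3, i.coeFn_compLpL (p := 2) (μ := timeMeasure T) (u - u₁)] with t ht ht'
    rw [ht] at ht'
    exact (map_eq_zero_iff i hi).1 ht'.symm
  exact (sub_eq_zero.1 h4).symm

/-- The sequence is bounded in `M^{2,2}`, so `ι ū → ι u` strongly in `L²(0,T;U)`. -/
lemma trace_tendsto {i : V →L[ℝ] H} {ι : V →L[ℝ] U} (hU : HypU i T ι) {τ : ℕ → ℝ}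
    {x : ℕ → ℕ → V} {u : Lp V 2 (timeMeasure T)}
    {R : ℝ≥0} (hR : ∀ n, InMBall i T R (pwConst (τ n) (x n)))
    (hconst : WeakTendstoL2 T (fun n => pwConst (τ n) (x n)) u) :
    Tendsto (fun n => lpNorm (fun t => ι (pwConst (τ n) (x n) t) - ι (u t)) 2
      (timeMeasure T)) atTop (𝓝 0) := by
  have h1 := hconst.map ι
  obtain ⟨h2, h3⟩ := h1
  have h4 := h3.tendsto_of_isCompact (hU.nemytskii R) fun n =>
    subset_closure ⟨pwConst (τ n) (x n), hR n, (h2 n).coeFn_toLp⟩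
  have h5 := (strongTendstoL2_iff h2).1 ⟨h2, h4⟩
  refine h5.congr fun n => ?_
  refine lpNorm_congr_of_ae_eq ?_
  filter_upwards [ι.coeFn_compLpL (p := 2) (μ := timeMeasure T) u] with t ht
  rw [ht]

lemma exists_inMBall {i : V →L[ℝ] H} {τ : ℕ → ℝ} {N : ℕ → ℕ} (hτpos : ∀ n, 0 < τ n)
    (hN : ∀ n, N n * τ n = T) {x : ℕ → ℕ → V} {u : Lp V 2 (timeMeasure T)}
    {u₂ : Lp (StrongDual ℝ V) 2 (timeMeasure T)}
    (hconst : WeakTendstoL2 T (fun n => pwConst (τ n) (x n)) u)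
    (hderiv : WeakTendstoL2 T (fun n t => embDual i (pwSlope (τ n) (x n) t)) u₂) :
    ∃ R : ℝ≥0, ∀ n, InMBall i T R (pwConst (τ n) (x n)) := by
  obtain ⟨M, -, hM⟩ := hconst.exists_lpNorm_le
  obtain ⟨M', -, hM'⟩ := hderiv.exists_lpNorm_le
  exact ⟨_, fun n => inMBall_pwConst i (hτpos n) (hN n) (x n) (hM n) (hM' n)⟩

lemma exists_lpNorm_reaction_le {ι : V →L[ℝ] U} {c : ℝ} (hc : 0 < c) {τ : ℕ → ℝ} {N : ℕ → ℕ}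
    (hτpos : ∀ n, 0 < τ n) (hN : ∀ n, N n * τ n = T) {x : ℕ → ℕ → V} {u : Lp V 2 (timeMeasure T)}
    (hconst : WeakTendstoL2 T (fun n => pwConst (τ n) (x n)) u) {ξ : ℕ → ℕ → StrongDual ℝ U}
    (hξ : ∀ n k, 1 ≤ k → k ≤ N n → ‖ξ n k‖ ≤ c * (1 + ‖ι (x n k)‖)) :
    ∃ M, 0 ≤ M ∧ ∀ n, lpNorm (pwConst (τ n) (ξ n)) 2 (timeMeasure T) ≤ M := by
  obtain ⟨M, hM0, hM⟩ := (hconst.map ι).exists_lpNorm_le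
  refine ⟨lpNorm (fun _ : ℝ => c) 2 (timeMeasure T) + c * M,
    add_nonneg lpNorm_nonneg (by positivity), fun n => ?_⟩
  have h1 : MemLp (fun _ : ℝ => c) 2 (timeMeasure T) := memLp_const c
  have h2 : MemLp (fun t => ‖ι (pwConst (τ n) (x n) t)‖) 2 (timeMeasure T) :=
    ((hconst.map ι).memLp n).norm
  have h3 := h1.add (h2.const_smul c)
  refine (lpNorm_le_of_norm_le (memLp_pwConst (hτpos n) (hN n) (ξ n) 2).1 h3 ?_).trans ?_
  · filter_upwards [ae_restrict_mem measurableSet_Ioo] with t ht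
    obtain ⟨hk1, hkN⟩ := ceil_div_mem (hτpos n) (hN n) (Set.Ioo_subset_Ioc_self ht)
    refine (hξ n _ hk1 hkN).trans ((le_abs_self _).trans (le_of_eq ?_))
    simp only [Pi.add_apply, Pi.smul_apply, smul_eq_mul, Real.norm_eq_abs, pwConst]
    ring_nf
  · refine (lpNorm_add_le h1 (by norm_num)).trans ?_
    rw [lpNorm_const_smul, lpNorm_norm ((hconst.map ι).memLp n).1]
    simp only [coe_nnnorm, Real.norm_of_nonneg hc.le]
    gcongr
    exact hM n

end Limit

/-! ### Strong convergence in `L²(0,T;V)` under the `(S₊)` condition -/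

section SPlus

/-- If `b n, c n → L` and `a n + a m` is bounded below by a quantity which tends to
`b n + c n - o(1)` as `m → ∞` for each fixed `n`, then `liminf (a n - b n) ≥ 0`. -/
lemma eventually_sub_le_of_double_limit {a b c q' : ℕ → ℝ} {q : ℕ → ℕ → ℝ} {L : ℝ}
    (hb : Tendsto b atTop (𝓝 L)) (hc : Tendsto c atTop (𝓝 L)) (hq' : Tendsto q' atTop (𝓝 0))
    (hq : ∀ n, Tendsto (q n) atTop (𝓝 (b n + c n - q' n))) (hle : ∀ n m, q n m ≤ a n + a m)
    {ε : ℝ} (hε : 0 < ε) : ∀ᶠ n in atTop, b n - ε ≤ a n := by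
  by_contra hcon
  have hfreq : ∃ᶠ n in atTop, a n < b n - ε := by
    rw [not_eventually] at hcon
    exact hcon.mono fun n hn => not_le.1 hn
  have hε4 : 0 < ε / 4 := by positivity
  have hb1 := hb.eventually_lt_const (show L < L + ε / 4 by linarith)
  have hc1 := hc.eventually_const_lt (show L - ε / 4 < L by linarith)
  have hq1 := hq'.eventually_lt_const hε4
  obtain ⟨n, han, hcn, hqn⟩ := (hfreq.and_eventually (hc1.and hq1)).exists
  have hm := (hq n).eventually_const_lt
    (show b n + c n - q' n - ε / 4 < b n + c n - q' n by linarith)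
  obtain ⟨m, ham, hbm, hqm⟩ := (hfreq.and_eventually (hb1.and hm)).exists
  linarith [hle n m]

variable {T : ℝ} {V H U : Type*} [NormedAddCommGroup V] [NormedSpace ℝ V] [NormedAddCommGroup H]
  [InnerProductSpace ℝ H] [NormedAddCommGroup U] [NormedSpace ℝ U]
  {i : V →L[ℝ] H} {ι : V →L[ℝ] U} {A : V → StrongDual ℝ V} {τ : ℕ → ℝ} {N : ℕ → ℕ}
  {F : ℕ → ℕ → StrongDual ℝ V} {x : ℕ → ℕ → V} {ξ : ℕ → ℕ → StrongDual ℝ U}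
  {f : Lp (StrongDual ℝ V) 2 (timeMeasure T)} {u : Lp V 2 (timeMeasure T)}
  {u₂ : Lp (StrongDual ℝ V) 2 (timeMeasure T)} {u₀ : H}

namespace ConvergentScheme

lemma horizon_nonneg (h : ConvergentScheme i ι A T τ N F x ξ f u u₂ u₀) : 0 ≤ T := by
  rw [← h.grid 0]
  have := (h.step_pos 0).le
  positivity

/-- `liminf ∫ ⟨u_n', u_n - u⟩ ≥ 0`. The energy identity for `u_n - u_m` at time `T` bounds
`∫ ⟨u_n', u_n⟩ + ∫ ⟨u_m', u_m⟩` from below by cross terms, which converge when first `m → ∞` and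
then `n → ∞`. -/
lemma eventually_le_integral_slope (h : ConvergentScheme i ι A T τ N F x ξ f u u₂ u₀) {ε : ℝ}
    (hε : 0 < ε) : ∀ᶠ n in atTop,
    (∫ t, embDual i (pwSlope (τ n) (x n) t) (u t) ∂(timeMeasure T)) - ε ≤
      ∫ t, embDual i (pwSlope (τ n) (x n) t) (pwLinear (τ n) (x n) t) ∂(timeMeasure T) := by
  set D : ℕ → ℝ → StrongDual ℝ V := fun n t => embDual i (pwSlope (τ n) (x n) t) with hD
  set P : ℕ → ℝ → V := fun n => pwLinear (τ n) (x n) with hP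
  have hDm : ∀ n, MemLp (D n) 2 (timeMeasure T) := h.deriv.memLp
  have hPm : ∀ n, MemLp (P n) 2 (timeMeasure T) := h.linear.memLp
  have hint : ∀ n m, Integrable (fun t => D n t (P m t)) (timeMeasure T) := fun n m =>
    integrable_pairing (ContinuousLinearMap.id ℝ (StrongDual ℝ V)) (hDm n) (hPm m)
  refine eventually_sub_le_of_double_limit
    (a := fun n => ∫ t, D n t (P n t) ∂(timeMeasure T))
    (b := fun n => ∫ t, D n t (u t) ∂(timeMeasure T))
    (c := fun n => ∫ t, u₂ t (P n t) ∂(timeMeasure T))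
    (q' := fun n => ‖i (x n 0) - u₀‖ ^ 2 / 2)
    (q := fun n m => (∫ t, D n t (P m t) ∂(timeMeasure T)) +
      (∫ t, D m t (P n t) ∂(timeMeasure T)) - ‖i (x n 0) - i (x m 0)‖ ^ 2 / 2)
    (L := ∫ t, u₂ t (u t) ∂(timeMeasure T)) ?_ ?_ ?_ ?_ ?_ hε
  · exact h.deriv.tendsto_integral (NormedSpace.inclusionInDoubleDual ℝ V) (Lp.memLp u)
  · exact h.linear.tendsto_integral (ContinuousLinearMap.id ℝ (StrongDual ℝ V)) (Lp.memLp u₂)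
  · have := ((h.initial.sub_const u₀).norm.pow 2).div_const 2
    simpa using this
  · intro n
    refine Tendsto.sub (Tendsto.add ?_ ?_) ?_
    · exact h.linear.tendsto_integral (ContinuousLinearMap.id ℝ (StrongDual ℝ V)) (hDm n)
    · exact h.deriv.tendsto_integral (NormedSpace.inclusionInDoubleDual ℝ V) (hPm n)
    · exact ((h.initial.const_sub (i (x n 0))).norm.pow 2).div_const 2
  · intro n m
    have hE := norm_pwLinear_sub_sq i (h.step_pos n) (h.grid n) (h.step_pos m) (h.grid m) (x n)
      (x m) (Set.right_mem_Icc.2 h.horizon_nonneg) (hPm n) (hPm m)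
    have hset : ∫ t in Set.Iic T, inner ℝ (i (pwSlope (τ n) (x n) t - pwSlope (τ m) (x m) t))
        (i (P n t - P m t)) ∂(timeMeasure T) =
        ∫ t, (D n t (P n t) + D m t (P m t) - (D n t (P m t) + D m t (P n t)))
          ∂(timeMeasure T) := by
      rw [setIntegral_eq_integral_of_ae_compl_eq_zero]
      · refine integral_congr_ae (.of_forall fun t => ?_)
        simp only [hD, embDual_apply, map_sub, inner_sub_left, inner_sub_right]
        ring
      · filter_upwards [ae_restrict_mem measurableSet_Ioo] with t ht ht'
        exact absurd ht.2.le ht'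
    have hi1 : Integrable (fun t => D n t (P n t) + D m t (P m t)) (timeMeasure T) :=
      (hint n n).add (hint m m)
    have hi2 : Integrable (fun t => D n t (P m t) + D m t (P n t)) (timeMeasure T) :=
      (hint n m).add (hint m n)
    rw [hset, integral_sub hi1 hi2, integral_add (hint n n) (hint m m),
      integral_add (hint n m) (hint m n), map_sub i (pwLinear _ _ _)] at hE
    have h1 := sq_nonneg ‖i (P n T - P m T)‖
    rw [map_sub] at h1
    have h2 : ‖i (x n 0 - x m 0)‖ = ‖i (x n 0) - i (x m 0)‖ := by rw [map_sub]
    rw [h2] at hE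
    linarith

/-- The upper limit of `∫ ⟨A ū_n, ū_n - u⟩` is nonpositive. -/
lemma limsup_integral_le (h : ConvergentScheme i ι A T τ N F x ξ f u u₂ u₀) :
    limsup (fun n => ((∫ t, A (pwConst (τ n) (x n) t) (pwConst (τ n) (x n) t - u t)
      ∂(timeMeasure T) : ℝ) : EReal)) atTop ≤ 0 := by
  set Q : ℕ → ℝ → V := fun n => pwConst (τ n) (x n) with hQ
  set G : ℕ → ℝ → StrongDual ℝ V := fun n => pwConst (τ n) (F n) with hG
  set Ξ : ℕ → ℝ → StrongDual ℝ U := fun n => pwConst (τ n) (ξ n) with hΞ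
  set D : ℕ → ℝ → StrongDual ℝ V := fun n t => embDual i (pwSlope (τ n) (x n) t) with hD
  set P : ℕ → ℝ → V := fun n => pwLinear (τ n) (x n) with hP
  have hDm : ∀ n, MemLp (D n) 2 (timeMeasure T) := h.deriv.memLp
  have hPm : ∀ n, MemLp (P n) 2 (timeMeasure T) := h.linear.memLp
  have hQm : ∀ n, MemLp (Q n) 2 (timeMeasure T) := h.const.memLp
  have hGm : ∀ n, MemLp (G n) 2 (timeMeasure T) :=
    fun n => memLp_pwConst (h.step_pos n) (h.grid n) _ 2
  have hΞm : ∀ n, MemLp (Ξ n) 2 (timeMeasure T) :=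
    fun n => memLp_pwConst (h.step_pos n) (h.grid n) _ 2
  have hum := Lp.memLp u
  have hwm : ∀ n, MemLp (fun t => Q n t - u t) 2 (timeMeasure T) := fun n => (hQm n).sub hum
  have hιm : ∀ n, MemLp (fun t => ι (Q n t) - ι (u t)) 2 (timeMeasure T) :=
    fun n => (ι.comp_memLp' (hQm n)).sub (ι.comp_memLp' hum)
  have hdm : ∀ n, MemLp (fun t => G n t - f t) 2 (timeMeasure T) :=
    fun n => (hGm n).sub (Lp.memLp f)
  obtain ⟨M, hM0, hM⟩ := (h.const.sub (weakTendstoL2_const u)).exists_lpNorm_le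
  obtain ⟨K, hK0, hK⟩ := h.reaction
  -- everything except the term with `u'` tends to zero
  set r : ℕ → ℝ := fun n => lpNorm (fun t => G n t - f t) 2 (timeMeasure T) * M +
    ((∫ t, f t (Q n t) ∂(timeMeasure T)) - ∫ t, f t (u t) ∂(timeMeasure T)) +
    K * lpNorm (fun t => ι (Q n t) - ι (u t)) 2 (timeMeasure T) with hr
  have hr0 : Tendsto r atTop (𝓝 0) := by
    have h1 := (h.const.tendsto_integral (ContinuousLinearMap.id ℝ (StrongDual ℝ V))
      (Lp.memLp f)).sub_const (∫ t, f t (u t) ∂(timeMeasure T))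
    have h2 := ((h.source.mul_const M).add h1).add (h.trace.const_mul K)
    simpa using h2
  have hle : ∀ n, ∫ t, A (Q n t) (Q n t - u t) ∂(timeMeasure T) ≤
      r n - ((∫ t, D n t (P n t) ∂(timeMeasure T)) - ∫ t, D n t (u t) ∂(timeMeasure T)) := by
    intro n
    have i1 : Integrable (fun t => f t (Q n t)) (timeMeasure T) :=
      integrable_pairing (ContinuousLinearMap.id ℝ (StrongDual ℝ V)) (Lp.memLp f) (hQm n)
    have i2 : Integrable (fun t => f t (u t)) (timeMeasure T) :=
      integrable_pairing (ContinuousLinearMap.id ℝ (StrongDual ℝ V)) (Lp.memLp f) hum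
    have i3 : Integrable (fun t => D n t (P n t)) (timeMeasure T) :=
      integrable_pairing (ContinuousLinearMap.id ℝ (StrongDual ℝ V)) (hDm n) (hPm n)
    have i4 : Integrable (fun t => D n t (u t)) (timeMeasure T) :=
      integrable_pairing (ContinuousLinearMap.id ℝ (StrongDual ℝ V)) (hDm n) hum
    have i5 := integrable_norm_mul_norm (hdm n) (hwm n)
    have i6 := integrable_norm_mul_norm (hΞm n) (hιm n)
    have hAm : MemLp (fun t => A (Q n t)) 2 (timeMeasure T) :=
      memLp_pwConst (h.step_pos n) (h.grid n) (fun k => A (x n k)) 2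
    have i7 : Integrable (fun t => A (Q n t) (Q n t - u t)) (timeMeasure T) :=
      integrable_pairing (ContinuousLinearMap.id ℝ (StrongDual ℝ V)) hAm (hwm n)
    have i12 : Integrable (fun t => f t (Q n t) - f t (u t)) (timeMeasure T) := i1.sub i2
    have i34 : Integrable (fun t => D n t (P n t) - D n t (u t)) (timeMeasure T) := i3.sub i4
    have i8 : Integrable (fun t => ‖G n t - f t‖ * ‖Q n t - u t‖ + (f t (Q n t) - f t (u t)))
      (timeMeasure T) := i5.add i12
    have i9 : Integrable (fun t => ‖G n t - f t‖ * ‖Q n t - u t‖ + (f t (Q n t) - f t (u t)) +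
      ‖Ξ n t‖ * ‖ι (Q n t) - ι (u t)‖) (timeMeasure T) := i8.add i6
    have hstep : ∫ t, A (Q n t) (Q n t - u t) ∂(timeMeasure T) ≤
        ∫ t, (‖G n t - f t‖ * ‖Q n t - u t‖ + (f t (Q n t) - f t (u t)) +
          ‖Ξ n t‖ * ‖ι (Q n t) - ι (u t)‖ - (D n t (P n t) - D n t (u t))) ∂(timeMeasure T) := by
      refine integral_mono_ae i7 (i9.sub i34) ?_
      filter_upwards [ae_restrict_mem measurableSet_Ioo] with t ht
      have e1 := h.equation n t ht (Q n t - u t)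
      have e2 := embDual_pwSlope_gap_nonneg i (x n) (h.step_pos n) ht.1.le
      have e3 := (le_abs_self _).trans ((G n t - f t).le_opNorm (Q n t - u t))
      have e4 := (neg_le_abs _).trans ((Ξ n t).le_opNorm (ι (Q n t) - ι (u t)))
      simp only [hD, hP, hQ, hG, hΞ, map_sub, sub_apply] at e1 e2 e3 e4 ⊢
      linarith
    refine hstep.trans ?_
    rw [integral_sub i9 i34, integral_add i8 i6, integral_add i5 i12, integral_sub i1 i2,
      integral_sub i3 i4]
    have b1 := (integral_norm_mul_norm_le (hdm n) (hwm n)).trans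
      (mul_le_mul_of_nonneg_left (hM n) lpNorm_nonneg)
    have b2 := (integral_norm_mul_norm_le (hΞm n) (hιm n)).trans
      (mul_le_mul_of_nonneg_right (hK n) lpNorm_nonneg)
    simp only [hr]
    linarith
  refine EReal.le_of_forall_lt_iff_le.1 fun z hz => ?_
  have hz0 : 0 < z := by exact_mod_cast hz
  refine limsup_le_of_le (by isBoundedDefault) ?_
  filter_upwards [h.eventually_le_integral_slope (half_pos hz0),
    hr0.eventually_lt_const (half_pos hz0)] with n h1 h2
  have h3 := hle n
  rw [EReal.coe_le_coe_iff]
  linarith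

end ConvergentScheme

end SPlus

/-! ### Uniform convergence in `H` under the monotonicity type relation -/

section Uniform

/-- Gronwall's inequality in integral form. -/
lemma le_mul_exp_of_le_integral {T δ K : ℝ} (hδ : 0 ≤ δ) (hK : 0 ≤ K) {φ : ℝ → ℝ}
    (hφ : ContinuousOn φ (Set.Icc 0 T)) (h0 : ∀ s, 0 ≤ φ s)
    (h : ∀ s ∈ Set.Icc 0 T, φ s ≤ δ + K * ∫ t in (0 : ℝ)..s, φ t) :
    ∀ s ∈ Set.Icc 0 T, φ s ≤ δ * Real.exp (K * s) := by
  intro s hs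
  have hT : 0 ≤ T := hs.1.trans hs.2
  set ψ : ℝ → ℝ := Set.IccExtend hT (Set.domRestrict (Set.Icc 0 T) φ) with hψ
  have hψc : Continuous ψ := hφ.domRestrict.Icc_extend'
  have hψφ : ∀ t ∈ Set.Icc 0 T, ψ t = φ t := fun t ht => by
    rw [hψ, Set.IccExtend_of_mem hT _ ht]; rfl
  have hψ0 : ∀ t, 0 ≤ ψ t := fun t => h0 _
  have hI : ∀ t ∈ Set.Icc 0 T, ∫ r in (0 : ℝ)..t, φ r = ∫ r in (0 : ℝ)..t, ψ r := fun t ht =>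
    intervalIntegral.integral_congr fun r hr => by
      rw [Set.uIcc_of_le ht.1] at hr
      exact (hψφ r ⟨hr.1, hr.2.trans ht.2⟩).symm
  set G : ℝ → ℝ := fun t => δ + K * ∫ r in (0 : ℝ)..t, ψ r with hG
  have hGd : ∀ t, HasDerivAt G (K * ψ t) t := fun t =>
    ((intervalIntegral.integral_hasDerivAt_right (hψc.intervalIntegrable _ _)
      (hψc.stronglyMeasurableAtFilter _ _) hψc.continuousAt).const_mul K).const_add δ
  have hG0 : ∀ t ∈ Set.Icc 0 T, 0 ≤ G t := fun t ht =>
    add_nonneg hδ (mul_nonneg hK (intervalIntegral.integral_nonneg ht.1 fun r _ => hψ0 r))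
  have hφG : ∀ t ∈ Set.Icc 0 T, φ t ≤ G t := fun t ht => by
    simp only [hG]
    rw [← hI t ht]
    exact h t ht
  have := norm_le_gronwallBound_of_norm_deriv_right_le (f := G) (f' := fun t => K * ψ t)
    (δ := δ) (K := K) (ε := 0) (a := 0) (b := T)
    (fun t _ => (hGd t).continuousAt.continuousWithinAt) (fun t _ => (hGd t).hasDerivWithinAt)
    (by simp [hG, abs_of_nonneg hδ]) (fun t ht => by
      have ht' := Set.Ico_subset_Icc_self ht
      rw [Real.norm_of_nonneg (mul_nonneg hK (hψ0 t)), Real.norm_of_nonneg (hG0 t ht'), add_zero,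
        hψφ t ht']
      exact mul_le_mul_of_nonneg_left (hφG t ht') hK) s hs
  rw [gronwallBound_ε0, sub_zero, Real.norm_of_nonneg (hG0 s hs)] at this
  exact (hφG s hs).trans this

variable {T : ℝ} {V H U : Type*} [NormedAddCommGroup V] [NormedSpace ℝ V] [NormedAddCommGroup H]
  [InnerProductSpace ℝ H] [NormedAddCommGroup U] [NormedSpace ℝ U]
  {i : V →L[ℝ] H} {ι : V →L[ℝ] U} {A : V → StrongDual ℝ V} {τ : ℕ → ℝ} {N : ℕ → ℕ}
  {F : ℕ → ℕ → StrongDual ℝ V} {x : ℕ → ℕ → V} {ξ : ℕ → ℕ → StrongDual ℝ U}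
  {f : Lp (StrongDual ℝ V) 2 (timeMeasure T)} {u : Lp V 2 (timeMeasure T)}
  {u₂ : Lp (StrongDual ℝ V) 2 (timeMeasure T)} {u₀ : H}

lemma norm_add₃_sq_le {E : Type*} [SeminormedAddCommGroup E] (a b c : E) :
    ‖a + b + c‖ ^ 2 ≤ 3 * (‖a‖ ^ 2 + ‖b‖ ^ 2 + ‖c‖ ^ 2) := by
  calc ‖a + b + c‖ ^ 2 ≤ (‖a‖ + ‖b‖ + ‖c‖) ^ 2 := by gcongr; exact norm_add₃_le
    _ ≤ _ := by nlinarith [sq_nonneg (‖a‖ - ‖b‖), sq_nonneg (‖a‖ - ‖c‖), sq_nonneg (‖b‖ - ‖c‖)]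

/-- Two solutions of the implicit Euler equations at the same time, with `p, p'` the values of the
piecewise constant and `p - e, p' - e'` those of the piecewise linear interpolants. Dissipativity
removes `⟨s, e⟩` and `⟨s', e'⟩`, so only the mixed products of slopes and gaps remain. -/
lemma inner_slope_sub_le {m₂ : ℝ} (hm₂ : 0 ≤ m₂)
    (hA : ∀ v w : V, -(m₂ * ‖i (v - w)‖ ^ 2) ≤ (A v - A w) (v - w))
    {p p' s s' e e' : V} {ζ ζ' : StrongDual ℝ U} {g g' : StrongDual ℝ V}
    (h : ∀ v, embDual i s v + A p v + ζ (ι v) = g v)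
    (h' : ∀ v, embDual i s' v + A p' v + ζ' (ι v) = g' v)
    (he : 0 ≤ embDual i s e) (he' : 0 ≤ embDual i s' e') :
    inner ℝ (i (s - s')) (i ((p - e) - (p' - e'))) ≤ embDual i s e' + embDual i s' e +
      (‖g - g'‖ * ‖p - p'‖ + ‖ζ - ζ'‖ * ‖ι p - ι p'‖ + 3 * m₂ * (‖i e‖ ^ 2 + ‖i e'‖ ^ 2)) +
      3 * m₂ * ‖i ((p - e) - (p' - e'))‖ ^ 2 := by
  have h1 := h (p - p')
  have h1' := h' (p - p')
  have h2 := hA p p'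
  have h3 := (le_abs_self _).trans ((g - g').le_opNorm (p - p'))
  have h4 := (neg_le_abs _).trans ((ζ - ζ').le_opNorm (ι p - ι p'))
  have h5 := norm_add₃_sq_le (i ((p - e) - (p' - e'))) (i e) (-(i e'))
  have h6 : i ((p - e) - (p' - e')) + i e + -(i e') = i (p - p') := by
    simp only [map_sub]; abel
  rw [h6, norm_neg] at h5
  have h7 : m₂ * ‖i (p - p')‖ ^ 2 ≤ m₂ * (3 * (‖i ((p - e) - (p' - e'))‖ ^ 2 + ‖i e‖ ^ 2 +
      ‖i e'‖ ^ 2)) := mul_le_mul_of_nonneg_left h5 hm₂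
  have h8 : inner ℝ (i (s - s')) (i ((p - e) - (p' - e'))) =
      embDual i s (p - p') - embDual i s' (p - p') - embDual i s e - embDual i s' e' +
        embDual i s e' + embDual i s' e := by
    simp only [embDual_apply, map_sub, inner_sub_left, inner_sub_right]
    ring
  rw [h8]
  simp only [map_sub, sub_apply, embDual_apply] at h1 h1' h2 h3 h4 h7 he he' ⊢
  linarith

namespace ConvergentScheme

/-- The Gronwall estimate for two members of the sequence: only the initial values, the mixed
integrals of slopes and gaps, and terms `γ n + γ m` with `γ → 0` remain. -/
lemma norm_sub_sq_le (h : ConvergentScheme i ι A T τ N F x ξ f u u₂ u₀) {m₂ : ℝ} (hm₂ : 0 ≤ m₂)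
    (hA : ∀ v w : V, -(m₂ * ‖i (v - w)‖ ^ 2) ≤ (A v - A w) (v - w)) :
    ∃ γ : ℕ → ℝ, Tendsto γ atTop (𝓝 0) ∧ ∀ n m, ∀ δ : ℝ, 0 ≤ δ →
      (∀ s ∈ Set.Icc 0 T,
        (∫ t in Set.Iic s, embDual i (pwSlope (τ n) (x n) t)
          (pwConst (τ m) (x m) t - pwLinear (τ m) (x m) t) ∂(timeMeasure T)) +
        (∫ t in Set.Iic s, embDual i (pwSlope (τ m) (x m) t)
          (pwConst (τ n) (x n) t - pwLinear (τ n) (x n) t) ∂(timeMeasure T)) ≤ δ) →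
      ∀ s ∈ Set.Icc 0 T, ‖i (pwLinear (τ n) (x n) s) - i (pwLinear (τ m) (x m) s)‖ ^ 2 ≤
        (‖i (x n 0) - i (x m 0)‖ ^ 2 + 2 * (δ + |γ n| + |γ m|)) * Real.exp (6 * m₂ * T) := by
  set Q : ℕ → ℝ → V := fun n => pwConst (τ n) (x n) with hQ
  set G : ℕ → ℝ → StrongDual ℝ V := fun n => pwConst (τ n) (F n) with hG
  set Ξ : ℕ → ℝ → StrongDual ℝ U := fun n => pwConst (τ n) (ξ n) with hΞ
  set D : ℕ → ℝ → StrongDual ℝ V := fun n t => embDual i (pwSlope (τ n) (x n) t) with hD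
  set P : ℕ → ℝ → V := fun n => pwLinear (τ n) (x n) with hP
  have hDm : ∀ n, MemLp (D n) 2 (timeMeasure T) := h.deriv.memLp
  have hPm : ∀ n, MemLp (P n) 2 (timeMeasure T) := h.linear.memLp
  have hQm : ∀ n, MemLp (Q n) 2 (timeMeasure T) := h.const.memLp
  have hGm : ∀ n, MemLp (G n) 2 (timeMeasure T) :=
    fun n => memLp_pwConst (h.step_pos n) (h.grid n) _ 2
  have hΞm : ∀ n, MemLp (Ξ n) 2 (timeMeasure T) :=
    fun n => memLp_pwConst (h.step_pos n) (h.grid n) _ 2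
  have hum := Lp.memLp u
  have hem : ∀ n, MemLp (fun t => Q n t - P n t) 2 (timeMeasure T) := fun n => (hQm n).sub (hPm n)
  have hiem : ∀ n, MemLp (fun t => i (Q n t - P n t)) 2 (timeMeasure T) :=
    fun n => i.comp_memLp' (hem n)
  have hιm : ∀ n, MemLp (fun t => ι (Q n t) - ι (u t)) 2 (timeMeasure T) :=
    fun n => (ι.comp_memLp' (hQm n)).sub (ι.comp_memLp' hum)
  have hdm : ∀ n, MemLp (fun t => G n t - f t) 2 (timeMeasure T) :=
    fun n => (hGm n).sub (Lp.memLp f)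
  obtain ⟨M, hM0, hM⟩ := h.const.exists_lpNorm_le
  obtain ⟨K, hK0, hK⟩ := h.reaction
  set γ : ℕ → ℝ := fun n => lpNorm (fun t => G n t - f t) 2 (timeMeasure T) * (2 * M) +
    (2 * K) * lpNorm (fun t => ι (Q n t) - ι (u t)) 2 (timeMeasure T) +
    3 * m₂ * lpNorm (fun t => i (Q n t - P n t)) 2 (timeMeasure T) ^ 2 with hγ
  refine ⟨γ, ?_, fun n m δ hδ hcross => ?_⟩
  · have := ((h.source.mul_const (2 * M)).add (h.trace.const_mul (2 * K))).add
      ((h.gap.pow 2).const_mul (3 * m₂))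
    rw [zero_mul, mul_zero, zero_pow two_ne_zero, mul_zero, add_zero, add_zero] at this
    exact this
  -- the compact terms
  set R : ℝ → ℝ := fun t => ‖G n t - G m t‖ * ‖Q n t - Q m t‖ +
    ‖Ξ n t - Ξ m t‖ * ‖ι (Q n t) - ι (Q m t)‖ +
    3 * m₂ * (‖i (Q n t - P n t)‖ ^ 2 + ‖i (Q m t - P m t)‖ ^ 2) with hR
  have hGG : MemLp (fun t => G n t - G m t) 2 (timeMeasure T) := (hGm n).sub (hGm m)
  have hQQ : MemLp (fun t => Q n t - Q m t) 2 (timeMeasure T) := (hQm n).sub (hQm m)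
  have hΞΞ : MemLp (fun t => Ξ n t - Ξ m t) 2 (timeMeasure T) := (hΞm n).sub (hΞm m)
  have hιι : MemLp (fun t => ι (Q n t) - ι (Q m t)) 2 (timeMeasure T) :=
    (ι.comp_memLp' (hQm n)).sub (ι.comp_memLp' (hQm m))
  have j1 := integrable_norm_mul_norm hGG hQQ
  have j2 := integrable_norm_mul_norm hΞΞ hιι
  have j3 : Integrable (fun t => 3 * m₂ * (‖i (Q n t - P n t)‖ ^ 2 + ‖i (Q m t - P m t)‖ ^ 2))
    (timeMeasure T) := (((hiem n).norm.integrable_sq).add ((hiem m).norm.integrable_sq)).const_mul _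
  have j12 : Integrable (fun t => ‖G n t - G m t‖ * ‖Q n t - Q m t‖ +
    ‖Ξ n t - Ξ m t‖ * ‖ι (Q n t) - ι (Q m t)‖) (timeMeasure T) := j1.add j2
  have jR : Integrable R (timeMeasure T) := j12.add j3
  have hR0 : ∀ t, 0 ≤ R t := fun t => by simp only [hR]; positivity
  have hRle : ∫ t, R t ∂(timeMeasure T) ≤ |γ n| + |γ m| := by
    have k1 : lpNorm (fun t => G n t - G m t) 2 (timeMeasure T) ≤
        lpNorm (fun t => G n t - f t) 2 (timeMeasure T) +
        lpNorm (fun t => G m t - f t) 2 (timeMeasure T) := by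
      refine le_trans (le_of_eq ?_) (lpNorm_sub_le (g := fun t => G m t - f t) (hdm n) (by norm_num))
      congr 1
      ext1 t
      simp
    have k2 : lpNorm (fun t => ι (Q n t) - ι (Q m t)) 2 (timeMeasure T) ≤
        lpNorm (fun t => ι (Q n t) - ι (u t)) 2 (timeMeasure T) +
        lpNorm (fun t => ι (Q m t) - ι (u t)) 2 (timeMeasure T) := by
      refine le_trans (le_of_eq ?_)
        (lpNorm_sub_le (g := fun t => ι (Q m t) - ι (u t)) (hιm n) (by norm_num))
      congr 1
      ext1 t
      simp
    have k3 : lpNorm (fun t => Q n t - Q m t) 2 (timeMeasure T) ≤ 2 * M :=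
      (lpNorm_sub_le (g := Q m) (hQm n) (by norm_num)).trans (by linarith [hM n, hM m])
    have k4 : lpNorm (fun t => Ξ n t - Ξ m t) 2 (timeMeasure T) ≤ 2 * K :=
      (lpNorm_sub_le (g := Ξ m) (hΞm n) (by norm_num)).trans (by linarith [hK n, hK m])
    have k5 := (integral_norm_mul_norm_le hGG hQQ).trans
      (mul_le_mul k1 k3 lpNorm_nonneg (add_nonneg lpNorm_nonneg lpNorm_nonneg))
    have k6 := (integral_norm_mul_norm_le hΞΞ hιι).trans
      (mul_le_mul k4 k2 lpNorm_nonneg (by positivity))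
    have k7 : ∫ t, R t ∂(timeMeasure T) ≤ γ n + γ m := by
      simp only [hR]
      rw [integral_add j12 j3, integral_add j1 j2, integral_const_mul,
        integral_add (hiem n).norm.integrable_sq (hiem m).norm.integrable_sq,
        integral_norm_sq_eq (hiem n), integral_norm_sq_eq (hiem m)]
      simp only [hγ]
      linarith
    exact k7.trans (add_le_add (le_abs_self _) (le_abs_self _))
  set φ : ℝ → ℝ := fun s => ‖i (P n s - P m s)‖ ^ 2 with hφ
  have jφ : Integrable φ (timeMeasure T) :=
    (i.comp_memLp' ((hPm n).sub (hPm m))).norm.integrable_sq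
  have jc1 : Integrable (fun t => D n t (Q m t - P m t)) (timeMeasure T) :=
    integrable_pairing (ContinuousLinearMap.id ℝ (StrongDual ℝ V)) (hDm n) (hem m)
  have jc2 : Integrable (fun t => D m t (Q n t - P n t)) (timeMeasure T) :=
    integrable_pairing (ContinuousLinearMap.id ℝ (StrongDual ℝ V)) (hDm m) (hem n)
  have jc : Integrable (fun t => D n t (Q m t - P m t) + D m t (Q n t - P n t)) (timeMeasure T) :=
    jc1.add jc2
  have jcR : Integrable (fun t => D n t (Q m t - P m t) + D m t (Q n t - P n t) + R t)
    (timeMeasure T) := jc.add jR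
  have jE : Integrable (fun t => inner ℝ (i (pwSlope (τ n) (x n) t - pwSlope (τ m) (x m) t))
      (i (P n t - P m t))) (timeMeasure T) :=
    integrable_pairing (innerSL ℝ)
      (i.comp_memLp' ((memLp_pwSlope (h.step_pos n) (h.grid n) (x n) 2).sub
        (memLp_pwSlope (h.step_pos m) (h.grid m) (x m) 2)))
      (i.comp_memLp' ((hPm n).sub (hPm m)))
  have hint : ∀ s ∈ Set.Icc 0 T, φ s ≤ (‖i (x n 0) - i (x m 0)‖ ^ 2 + 2 * (δ + |γ n| + |γ m|)) +
      6 * m₂ * ∫ t in (0 : ℝ)..s, φ t := by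
    intro s hs
    have hE := norm_pwLinear_sub_sq i (h.step_pos n) (h.grid n) (h.step_pos m) (h.grid m) (x n)
      (x m) hs (hPm n) (hPm m)
    have hmono : ∫ t in Set.Iic s, inner ℝ (i (pwSlope (τ n) (x n) t - pwSlope (τ m) (x m) t))
        (i (P n t - P m t)) ∂(timeMeasure T) ≤
        ∫ t in Set.Iic s, (D n t (Q m t - P m t) + D m t (Q n t - P n t) + R t +
          3 * m₂ * φ t) ∂(timeMeasure T) := by
      refine integral_mono_ae jE.integrableOn (jcR.add (jφ.const_mul (3 * m₂))).integrableOn ?_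
      refine ae_restrict_of_ae ?_
      filter_upwards [ae_restrict_mem measurableSet_Ioo] with t ht
      have := inner_slope_sub_le hm₂ hA (h.equation n t ht) (h.equation m t ht)
        (embDual_pwSlope_gap_nonneg i (x n) (h.step_pos n) ht.1.le)
        (embDual_pwSlope_gap_nonneg i (x m) (h.step_pos m) ht.1.le)
      simp only [sub_sub_cancel] at this
      exact this
    rw [integral_add jcR.integrableOn (jφ.const_mul (3 * m₂)).integrableOn,
      integral_add jc.integrableOn jR.integrableOn,
      integral_add jc1.integrableOn jc2.integrableOn, integral_const_mul,
      integral_timeMeasure_Iic hs φ] at hmono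
    have hRs : ∫ t in Set.Iic s, R t ∂(timeMeasure T) ≤ |γ n| + |γ m| :=
      (setIntegral_le_integral jR (.of_forall hR0)).trans hRle
    have hc := hcross s hs
    have hE' : φ s = ‖i (x n 0) - i (x m 0)‖ ^ 2 + 2 * ∫ t in Set.Iic s,
        inner ℝ (i (pwSlope (τ n) (x n) t - pwSlope (τ m) (x m) t))
        (i (P n t - P m t)) ∂(timeMeasure T) := by
      rw [← map_sub]; exact hE
    linarith
  intro s hs
  have hcont : ContinuousOn φ (Set.Icc 0 T) :=
    (i.continuous.comp_continuousOn ((continuousOn_pwLinear (h.step_pos n) (h.grid n) (x n)).sub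
      (continuousOn_pwLinear (h.step_pos m) (h.grid m) (x m)))).norm.pow 2
  have hmain := le_mul_exp_of_le_integral (by positivity) (by positivity) hcont
    (fun s => sq_nonneg _) hint s hs
  rw [← map_sub]
  refine hmain.trans ?_
  gcongr
  exact hs.2

/-- The uniform Cauchy property, as an iterated limit: the mixed integrals of the slope at stage `n`
and the gap at stage `m` vanish only when `m → ∞` with `n` fixed. -/
lemma eventually_eventually_norm_sub_sq_le (h : ConvergentScheme i ι A T τ N F x ξ f u u₂ u₀)
    (hA : MonotoneType i A) {η : ℝ} (hη : 0 < η) :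
    ∀ᶠ n in atTop, ∀ᶠ m in atTop, ∀ s ∈ Set.Icc 0 T,
      ‖i (pwLinear (τ n) (x n) s) - i (pwLinear (τ m) (x m) s)‖ ^ 2 ≤ η := by
  obtain ⟨m₁, m₂, hm₁, hm₂, hA⟩ := hA
  have hA' : ∀ v w : V, -(m₂ * ‖i (v - w)‖ ^ 2) ≤ (A v - A w) (v - w) := fun v w =>
    le_trans (by have : 0 ≤ m₁ * ‖v - w‖ ^ 2 := by positivity
                 linarith) (hA v w)
  obtain ⟨γ, hγ, hmain⟩ := h.norm_sub_sq_le hm₂.le hA'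
  -- the initial values contribute `4 κ`, the mixed integrals `6 κ` and `γ n`, `γ m` together `4 κ`
  set κ : ℝ := η / Real.exp (6 * m₂ * T) / 16 with hκ
  have hκ0 : 0 < κ := by positivity
  have hγ' : ∀ᶠ n in atTop, |γ n| ≤ κ := by
    have := hγ.abs
    rw [abs_zero] at this
    exact this.eventually_le_const hκ0
  have hinit : ∀ᶠ n in atTop, ‖i (x n 0) - u₀‖ ^ 2 ≤ κ := by
    have : Tendsto (fun n => ‖i (x n 0) - u₀‖ ^ 2) atTop (𝓝 0) := by
      simpa using (h.initial.sub_const u₀).norm.pow 2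
    exact this.eventually_le_const hκ0
  have hgap : WeakTendstoL2 T (fun n t => pwConst (τ n) (x n) t - pwLinear (τ n) (x n) t) 0 := by
    have := h.const.sub h.linear
    rwa [sub_self] at this
  have hder : WeakTendstoL2 T (fun n t => embDual i (pwSlope (τ n) (x n) t) - u₂ t) 0 := by
    have := h.deriv.sub (weakTendstoL2_const u₂)
    rwa [sub_self] at this
  have hlim := eventually_forall_abs_setIntegral_le (ContinuousLinearMap.id ℝ (StrongDual ℝ V))
    (Lp.memLp u₂) hgap hκ0
  filter_upwards [hγ', hinit, hlim] with n hγn hinitn hlimn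
  have hc1 := eventually_forall_abs_setIntegral_le (ContinuousLinearMap.id ℝ (StrongDual ℝ V))
    (h.deriv.memLp n) hgap hκ0
  have hc2 := eventually_forall_abs_setIntegral_le (NormedSpace.inclusionInDoubleDual ℝ V)
    (hgap.memLp n) hder hκ0
  filter_upwards [hγ', hinit, hc1, hc2] with m hγm hinitm hc1m hc2m
  intro s hs
  refine (hmain n m (3 * κ) (by positivity) ?_ s hs).trans ?_
  · intro r hr
    have e1 := (le_abs_self _).trans (hc1m r hr)
    have e2 := (le_abs_self _).trans (hc2m r hr)
    have e3 := (le_abs_self _).trans (hlimn r hr)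
    have hsplit : ∫ t in Set.Iic r, embDual i (pwSlope (τ m) (x m) t)
        (pwConst (τ n) (x n) t - pwLinear (τ n) (x n) t) ∂(timeMeasure T) =
        (∫ t in Set.Iic r, (embDual i (pwSlope (τ m) (x m) t) - u₂ t)
          (pwConst (τ n) (x n) t - pwLinear (τ n) (x n) t) ∂(timeMeasure T)) +
        ∫ t in Set.Iic r, u₂ t
          (pwConst (τ n) (x n) t - pwLinear (τ n) (x n) t) ∂(timeMeasure T) := by
      rw [← integral_add]
      · refine integral_congr_ae (.of_forall fun t => ?_)
        simp only [sub_apply]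
        ring
      · exact (integrable_pairing (ContinuousLinearMap.id ℝ (StrongDual ℝ V)) (hder.memLp m)
          (hgap.memLp n)).integrableOn
      · exact (integrable_pairing (ContinuousLinearMap.id ℝ (StrongDual ℝ V)) (Lp.memLp u₂)
          (hgap.memLp n)).integrableOn
    simp only [ContinuousLinearMap.id_apply, NormedSpace.dual_def] at e1 e2 e3
    linarith
  · have e1 : ‖i (x n 0) - i (x m 0)‖ ^ 2 ≤ 4 * κ := by
      have e2 : ‖i (x n 0) - i (x m 0)‖ ≤ ‖i (x n 0) - u₀‖ + ‖i (x m 0) - u₀‖ := by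
        rw [norm_sub_rev (i (x m 0)) u₀]
        exact norm_sub_le_norm_sub_add_norm_sub _ _ _
      nlinarith [norm_nonneg (i (x n 0) - i (x m 0)), norm_nonneg (i (x n 0) - u₀),
        norm_nonneg (i (x m 0) - u₀), sq_nonneg (‖i (x n 0) - u₀‖ - ‖i (x m 0) - u₀‖)]
    have e3 : η = 16 * κ * Real.exp (6 * m₂ * T) := by rw [hκ]; field_simp
    rw [e3]
    gcongr
    linarith

/-- The uniform limit is a representative of `u`, since strong and weak limits in `L²(0,T;H)`
coincide. -/
lemma tendstoC [CompleteSpace H] (h : ConvergentScheme i ι A T τ N F x ξ f u u₂ u₀)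
    (hA : MonotoneType i A) :
    TendstoC T (fun n t => i (pwLinear (τ n) (x n) t)) (fun t => i (u t)) := by
  set w : ℕ → ℝ → H := fun n t => i (pwLinear (τ n) (x n) t) with hw
  have hwc : ∀ n, ContinuousOn (w n) (Set.Icc 0 T) := fun n =>
    i.continuous.comp_continuousOn (continuousOn_pwLinear (h.step_pos n) (h.grid n) (x n))
  have hcauchy : UniformCauchySeqOn w atTop (Set.Icc 0 T) := by
    rw [Metric.uniformCauchySeqOn_iff]
    intro ε hε
    obtain ⟨n, hn⟩ := (h.eventually_eventually_norm_sub_sq_le hA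
      (η := (ε / 3) ^ 2) (by positivity)).exists
    obtain ⟨m₀, hm₀⟩ := eventually_atTop.1 hn
    refine ⟨m₀, fun m hm m' hm' s hs => ?_⟩
    have h1 := abs_le_of_sq_le_sq (hm₀ m hm s hs) (by positivity)
    have h2 := abs_le_of_sq_le_sq (hm₀ m' hm' s hs) (by positivity)
    rw [abs_norm] at h1 h2
    have h3 := dist_triangle_left (w m s) (w m' s) (w n s)
    rw [dist_eq_norm (w n s), dist_eq_norm (w n s)] at h3
    linarith
  have hex : ∀ s, ∃ l, s ∈ Set.Icc 0 T → Tendsto (fun n => w n s) atTop (𝓝 l) := by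
    intro s
    by_cases hs : s ∈ Set.Icc 0 T
    · obtain ⟨l, hl⟩ := cauchySeq_tendsto_of_complete (hcauchy.cauchySeq hs)
      exact ⟨l, fun _ => hl⟩
    · exact ⟨0, fun h => absurd h hs⟩
  choose ũ hũ using hex
  have hunif : TendstoUniformlyOn w ũ atTop (Set.Icc 0 T) :=
    hcauchy.tendstoUniformlyOn_of_tendsto hũ
  have hũc : ContinuousOn ũ (Set.Icc 0 T) :=
    hunif.continuousOn (Frequently.of_forall hwc)
  refine ⟨ũ, hũc, ?_, hwc, hunif⟩
  have hũm : MemLp ũ 2 (timeMeasure T) := by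
    obtain ⟨B, hB⟩ := isCompact_Icc.exists_bound_of_continuousOn hũc
    refine MemLp.of_bound ((hũc.mono Set.Ioo_subset_Icc_self).aestronglyMeasurable
      measurableSet_Ioo) B ?_
    filter_upwards [ae_restrict_mem measurableSet_Ioo] with t ht
    exact hB t (Set.Ioo_subset_Icc_self ht)
  have hweak : WeakTendstoL2 T w (i.compLpL 2 (timeMeasure T) u) := h.linear.map i
  have hstrong : StrongTendstoL2 T w (hũm.toLp ũ) := by
    rw [strongTendstoL2_iff hweak.memLp]
    set k : ℝ := lpNorm (fun _ : ℝ => (1 : ℝ)) 2 (timeMeasure T) with hk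
    have hk0 : 0 ≤ k := lpNorm_nonneg
    rw [Metric.tendsto_atTop']
    intro ε hε
    have hev := Metric.tendstoUniformlyOn_iff.1 hunif (ε / (k + 1)) (by positivity)
    obtain ⟨n₀, hn₀⟩ := eventually_atTop.1 hev
    refine ⟨n₀, fun n hn => ?_⟩
    have h1 : lpNorm (fun t => w n t - hũm.toLp ũ t) 2 (timeMeasure T) ≤
        lpNorm ((ε / (k + 1)) • fun _ : ℝ => (1 : ℝ)) 2 (timeMeasure T) := by
      refine lpNorm_le_of_norm_le ((hweak.memLp n).sub (Lp.memLp _)).1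
        ((memLp_const (1 : ℝ)).const_smul _) ?_
      filter_upwards [ae_restrict_mem measurableSet_Ioo, hũm.coeFn_toLp] with t ht ht'
      rw [ht', ← dist_eq_norm, dist_comm]
      refine (hn₀ n hn.le t (Set.Ioo_subset_Icc_self ht)).le.trans ?_
      simp only [Pi.smul_apply, smul_eq_mul, mul_one]
      exact le_abs_self _
    rw [lpNorm_const_smul, coe_nnnorm, Real.norm_of_nonneg (by positivity), ← hk] at h1
    rw [Real.dist_eq, sub_zero, abs_of_nonneg lpNorm_nonneg]
    refine h1.trans_lt ?_
    rw [div_mul_eq_mul_div, div_lt_iff₀ (by positivity)]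
    nlinarith
  have heq := hweak.congr_limit hstrong.weakTendstoL2
  have h1 := i.coeFn_compLpL (p := 2) (μ := timeMeasure T) u
  rw [heq] at h1
  exact hũm.coeFn_toLp.symm.trans h1

end ConvergentScheme

end Uniform

end Rothe

end

/-! ### The convergence theorem -/

theorem mainTheorem3
    {V H U : Type*} [NormedAddCommGroup V] [NormedSpace ℝ V]
    [NormedAddCommGroup H] [InnerProductSpace ℝ H]
    [NormedAddCommGroup U] [NormedSpace ℝ U] [CompleteSpace U]
    (hUrefl : Rothe.IsReflexive U)
    (i : V →L[ℝ] H) (hi : Rothe.IsEvolutionTriple i)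
    (T : ℝ) (hT : 0 < T)
    (A : V → StrongDual ℝ V) (a b α β : ℝ) (hA : Rothe.HypA i A a b α β)
    (J : U → ℝ) (c : ℝ) (hJ : Rothe.HypJ J c)
    (ι : V →L[ℝ] U) (hU : Rothe.HypU i T ι)
    (haux : Rothe.HypAux i ι J α c)
    (f : Lp (StrongDual ℝ V) 2 (Rothe.timeMeasure T)) (u₀ : H)
    -- time steps
    (τ : ℕ → ℝ) (N : ℕ → ℕ) (hτpos : ∀ n, 0 < τ n) (hτN : ∀ n, N n * τ n = T)
    (hτ : Tendsto τ atTop (𝓝 0))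
    -- approximate data
    (F : ℕ → ℕ → StrongDual ℝ V) (hF : Rothe.IsSourceApprox T τ N f F)
    (u₀τ : ℕ → V) (hu₀ : Tendsto (fun n => i (u₀τ n)) atTop (𝓝 u₀))
    (C : ℝ) (hC : 0 < C) (hu₀τ : ∀ n, ‖u₀τ n‖ ≤ C / √(τ n))
    -- solutions of the Rothe problems
    (x : ℕ → ℕ → V)
    (hx : ∀ n, Rothe.IsRotheSolution i ι A J (τ n) (N n) (F n) (u₀τ n) (x n))
    -- convergence of the interpolants and of the derivatives of the piecewise linear ones
    (u u₁ : Lp V 2 (Rothe.timeMeasure T)) (u₂ : Lp (StrongDual ℝ V) 2 (Rothe.timeMeasure T))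
    (hconst : Rothe.WeakTendstoL2 T (fun n => Rothe.pwConst (τ n) (x n)) u)
    (hconst' : Rothe.WeakStarTendstoLinfty T
      (fun n t => i (Rothe.pwConst (τ n) (x n) t)) (fun t => i (u t)))
    (hlin : Rothe.WeakTendstoL2 T (fun n => Rothe.pwLinear (τ n) (x n)) u₁)
    (hlin' : Rothe.WeakStarTendstoLinfty T
      (fun n t => i (Rothe.pwLinear (τ n) (x n) t)) (fun t => i (u₁ t)))
    (hderiv : Rothe.WeakTendstoL2 T
      (fun n t => Rothe.embDual i (Rothe.pwSlope (τ n) (x n) t)) u₂) :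
    (Rothe.MonotoneType i A →
      Rothe.TendstoC T (fun n t => i (Rothe.pwLinear (τ n) (x n) t)) (fun t => i (u t))) ∧
    (Rothe.NemytskiiSPlus i T A →
      Rothe.StrongTendstoL2 T (fun n => Rothe.pwConst (τ n) (x n)) u) := by

  have heq : ∀ n, ∃ ξ : ℕ → StrongDual ℝ U, ∀ k, 1 ≤ k → k ≤ N n →
      ‖ξ k‖ ≤ c * (1 + ‖ι (x n k)‖) ∧ ∀ v : V,
        inner ℝ (i ((τ n)⁻¹ • (x n k - x n (k - 1)))) (i v) + A (x n k) v + ξ k (ι v) =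
          F n k v := by
    intro n
    have hk : ∀ k, ∃ ζ : StrongDual ℝ U, 1 ≤ k → k ≤ N n → ‖ζ‖ ≤ c * (1 + ‖ι (x n k)‖) ∧ ∀ v : V,
        inner ℝ (i ((τ n)⁻¹ • (x n k - x n (k - 1)))) (i v) + A (x n k) v + ζ (ι v) =
          F n k v := by
      intro k
      by_cases h : 1 ≤ k ∧ k ≤ N n
      · obtain ⟨ζ, hζ, hζ'⟩ := (hx n).2 k h.1 h.2
        exact ⟨ζ, fun _ _ => ⟨hJ.growth _ ζ hζ, hζ'⟩⟩
      · exact ⟨0, fun h1 h2 => absurd ⟨h1, h2⟩ h⟩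
    choose ξ hξ using hk
    exact ⟨ξ, hξ⟩
  choose ξ hξ using heq
  obtain ⟨hgap, rfl⟩ := Rothe.gap_tendsto_and_limit_eq hi.injective hτpos hτN hτ hconst hlin hderiv
  obtain ⟨R, hR⟩ := Rothe.exists_inMBall hτpos hτN hconst hderiv
  have hS : Rothe.ConvergentScheme i ι A T τ N F x ξ f u₁ u₂ u₀ :=
    { step_pos := hτpos
      grid := hτN
      equation := fun n t ht v => by
        obtain ⟨hk1, hkN⟩ := Rothe.ceil_div_mem (hτpos n) (hτN n) (Set.Ioo_subset_Ioc_self ht)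
        exact (hξ n _ hk1 hkN).2 v
      initial := hu₀.congr fun n => by rw [(hx n).1]
      const := hconst
      linear := hlin
      deriv := hderiv
      gap := hgap
      trace := Rothe.trace_tendsto hU hR hconst
      reaction := Rothe.exists_lpNorm_reaction_le hJ.hc hτpos hτN hconst
        fun n k h1 h2 => (hξ n k h1 h2).1
      source := by
        have h := hF.strongTendstoL2 hT hτpos hτN
        exact (Rothe.strongTendstoL2_iff h.1).1 h }
  have := hi.completeH
  exact ⟨fun hA₁ => hS.tendstoC hA₁, fun hA₂ => hA₂ _ _ hconst ⟨R, hR⟩ hS.limsup_integral_le⟩
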